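/- **Language.** Fix a first-order language of arithmetic with $0$, $S$, $=$ and further function and relation symbols, all with a fixed standard interpretation in $\mathbb N$, together with a unary predicate $I$; this is $\mathcal L_0$. A quantifier-free formula is *simple* if it contains no closed terms. $\mathcal L_{n+1}$ adds to $\mathcal L_n$ a $k$-ary Skolem function $c_{\exists x\,\phi}$ for each $\exists x\,\phi(x,y_1,\dots,y_k)$ with $\phi$ a simple quantifier-free formula of $\mathcal L_n$; $\mathcal L_\epsilon$ is the quantifier-free part of $\bigcup_n\mathcal L_n$, and the simple rank $rk_s$ of an expression is the least $n$ such that it lies in $\mathcal L_n$. For $\phi$ simple, $\exists x\,\phi(x,\vec t)$ abbreviates $\phi(c_{\exists x\phi}(\vec t),\vec t)$ and $\forall x\,\phi(x,\vec t)$ abbreviates $\phi(c_{\exists x\neg\phi}(\vec t),\vec t)$; $\phi\to\psi$ abbreviates $\neg\phi\vee\psi$. Fix a simple quantifier-free formula $B(x,y,X)$ of the language of arithmetic in which $X$ occurs, and only positively, and put $A(y,X)=\forall x\,B(x,y,X)$. Fix a finite list $Cr_0,\dots,Cr_N$ of closed critical formulas, each of one of the forms (with $\phi$ simple and $s,t,\vec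 s$ closed): *Pred* $\neg s=0\to\exists x\,s=Sx$; *Epsilon* $\phi(t,\vec s)\to\exists x\,\phi(x,\vec s)$; *Induction* $\phi(0,\vec s)\wedge\neg\phi(t,\vec s)\to\exists x(\phi(x,\vec s)\wedge\neg\phi(Sx,\vec s))$; *Inductive Definition* $A(t,I)\to t\in I$; *Closure* $\forall x(A(x,\phi)\to\phi(x,\vec s))\to\forall x(x\in I\to\phi(x,\vec s))$. **Expressions and ranks.** Canonical expressions are the terms $c(\vec n)$ with $c$ a Skolem function and $\vec n$ numerals, and the formulas $n\in I$. Write $c_n$ for $c_{\exists x\neg B(x,y,I)}(n)$. Ranks are $0<1<2<\dots<\Omega<\Omega+1<\dots$: $rk(n\in I)=rk(c_n)=\Omega$; for other terms $c(\vec n)$, $c=c_{\exists x\phi}$, $rk=rk_s(\phi)+1$ if $\phi$ does not contain $I$ (also not inside indices of Skolem functions), and $rk=\Omega+rk_s(\phi)+2$ if it does. **Substitutions.** An $\epsilon$-substitution $S$ is a partial function on canonical expressions; the values of terms are positive numerals or $?$, those of formulas are $\top$ or $?$. $\overline S$ extends $S$ by the value $?$ everywhere else. Closed terms and formulas are evaluated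 in $S$ with $?$ read as $0$ for terms and as false for formulas; evaluation is undefined if it needs a value outside $\operatorname{dom}S$ (all parts of a formula are evaluated). $S\vDash\phi$ means that $\phi$ evaluates to true in $S$; $S$ decides $\phi$ if $S\vDash\phi$ or $S\vDash\neg\phi$. $F(e,?)$ is a true formula, $F(c_{\exists x\phi}(\vec t),u)=\phi(u,\vec t)\wedge\bigwedge_{v<u}\neg\phi(v,\vec t)$, and $F(n\in I,\top)=A(n,I)$. $S$ is correct if $\overline S\vDash F(e,u)$ for all $(e,u)\in S$; it is computationally inconsistent if $S\vDash\neg F(e,u)$ for some $(e,u)\in S$, or $(c_n,u),(n\in I,\top)\in S$ for some $n$ and $u\ne{?}$; it is solving if $\overline S\vDash Cr_i$ for all $i$. $S^-_\Omega$ consists of the pairs $(c_n,u)$, $u\neq{?}$, and $(n\in I,?)$ in $S$; $S^+_\Omega$ of the pairs $(c_n,?)$ and $(n\in I,\top)$ in $S$. **Sequents.** A sequent $\Theta=(S,P,V,F)$ consists of an $\epsilon$-substitution $S$, a finite sequence $P$ without repetitions enumerating the formulas $n\in I$ with $S(n\in I)=\top$, a function $V$ on the entries of $P$ whose values are finite $\epsilon$-substitutions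 $T$ with $T^-_\Omega=T$, and $F:\{e\in\operatorname{dom}S: S(e)={?}\text{ or }rk(e)=\Omega\}\to\{t,f\}$. $\emptyset$ is the empty sequent. **$H$-step.** For $S\vDash\neg Cr_i$ define $(e_i,v_i)$, where $|s|$ denotes the value of $s$ in $S$: for Pred, $(c_{\exists x\,y=Sx}(|s|),|s|-1)$; for Epsilon, $(c_{\exists x\phi}(|\vec s|),|t|)$; for Induction, $e_i=c_{\exists x(\phi(x)\wedge\neg\phi(Sx))}(|\vec s|)$ and $v_i$ is the least $m<|t|$ with $S\vDash\phi(m,\vec s)$, $S\vDash\neg\phi(m+1,\vec s)$; for Inductive Definition, $(|t|\in I,\top)$; for Closure, let $n\in I$ be the first entry of $P$ with $S\vDash\neg\phi(n,\vec s)$: if $S\vDash\neg A(n,\phi)$ then $e_i=c_n$ and $v_i=S(c_{\exists z\neg B(z,x,\phi)}(n,|\vec s|))$, and if $S\vDash A(n,\phi)$ then $e_i=c_{\exists x\neg(A(x,\phi)\to\phi(x))}(|\vec s|)$ and $v_i=n$. The $H$-step applies to $\Theta$ if $S$ is correct and nonsolving and all calculations take place in $S$, that is: $S$ decides every $Cr_i$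 and every $F(c,u)$ with $(c,u)\in S$ and $c$ a term; every $(e_i,v_i)$ with $S\vDash\neg Cr_i$ is defined by evaluation in $S$ with $v_i$ a positive numeral or $\top$ (in the induction case also deciding the instances needed to find the least $m$, and in the closure case with $\phi(m,\vec s)$ true in $S$ for the earlier entries $m$ of $P$); and, for the pair $(e,v)=(e_i,v_i)$ with $rk(e_i)$ least and $i$ least among these, $(e,?)\in S$; if $e=c_n$ then $n\in I\in\operatorname{dom}S$; if $e$ is $n\in I$ then $c_n\in\operatorname{dom}S$; if $rk(e)=\Omega$, $e$ is a term and $(c_m,?)\in S$ then $m\in I\in\operatorname{dom}S$. Then $H(\Theta)$ is: - if $rk(e)\neq\Omega$: $S$ becomes $(S_{\le rk(e)}\setminus\{(e,?)\})\cup\{(e,v)\}$; $P,V$ are kept if $rk(e)>\Omega$ and become empty if $rk(e)<\Omega$; - if $e$ is $n\in I$: $(S_{<\Omega}\cup S^+_\Omega\setminus\{(e,?)\})\cup\{(e,\top)\}$, $P^\frown\langle n\in I\rangle$, $V\cup\{(n\in I,S^-_\Omega)\}$; - if $e=c_n$: with $P'$ the longest initial segment of $P$ not containing $n\in I$, $S'$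 the set of pairs $(c_m,?),(m\in I,\top)\in S$ with $m\in I$ in $P'$, and $V'=V(n\in I)$ if $n\in I$ is in $P$, $V'=S^-_\Omega$ otherwise: $S_{<\Omega}\cup S'\cup V'\cup\{(c_n,v)\}$, $P'$, $V\upharpoonright P'$; $F$ is kept where it still applies and is $t$ at new expressions. An $e'\in\operatorname{dom}S$ with $rk(e')=rk(e)$ is *active* if its value in $H(\Theta)$ is missing or differs from $S(e')$. **Deductions.** Axioms: *AxF*, $S$ computationally inconsistent; *AxS*, $S$ solving and deciding every $Cr_i$; *AxH*, the $H$-step applies and some active $e'$ has $F(e')=f$. Rules, with conclusion $\Theta$ and main expression $e$ (in all but $H$, $e\notin\operatorname{dom}\Theta$; $(e,\cdot),\Theta$ denotes $\Theta$ with the displayed data added; $u$ ranges over positive numerals): - $Cut_e$ and $CutFr_e$, for a term $e$ with $rk(e)\ne\Omega$: premises $(e,u),\Theta$ for all $u$, and $(e,?,f),\Theta$ for $Cut$, $(e,?,t),\Theta$ for $CutFr$; - $Cut^{\Omega,\mathrm{term}}_e$ and $CutFr^{\Omega,\mathrm{term}}_e$, for a term $e$ with $rk(e)=\Omega$: the same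 with $(e,u,f),\Theta$ in place of $(e,u),\Theta$; - $Cut^{\Omega,\mathrm{form}}_e$, for a formula $e=(n\in I)$: premises $(e,?,f),\Theta$ and $(e,\top,f,P_e,V_e),\Theta$ for all $P_e$ proper for $e,\Theta$ and all $V_e$ on $P_e$ with values as required of $V$. Here $P_e$ is a sequence of distinct formulas $m\in I$ outside $\operatorname{dom}\Theta$, ending in $e$, with $u={?}$ whenever $(c_m,u)\in\Theta$, and such that the concatenation $Q=P^\frown P_e$ is admissible, i.e. $B(0,m,I)$ is true for each entry $m$ of $Q$ when $I$ is the set of earlier entries; the premise gives all entries of $P_e$ the value $\top$ and the label $f$, and appends $P_e$ to $P$ and $V_e$ to $V$; - $Fr_e$: premise $(e,?,t),\Theta$; - $H_{e,v}$: premise $H(\Theta)$, if the $H$-step applies to $\Theta$ with $H$-expression $e$ and value $v$ and $F(e')=t$ for all active $e'$. A derivation is a well-founded tree built from axioms by these rules. It is an *$r$-derivation* if all $Cut$ rules (with their $\Omega$-variants) have main expressions of rank $<r$, there are no $CutFr$ rules, and all $Fr$ and $H$ rules have main expressions of rank $\ge r$. **Theorem.** Let $r\le\Omega$ be a rank and $\Theta$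 a sequent. Suppose there is an $\Omega$-derivation of $\Theta$, and there is a path $\emptyset=\Theta_0,\dots,\Theta_n=\Theta$ in which each $\Theta_{i+1}$ is a premise of an inference with conclusion $\Theta_i$, which is an $H$ or $Fr$ rule of rank $\ge\Omega$ or a $Cut$ rule of rank $\le r$. Then there is an $r$-derivation of $\Theta$. -/

import Mathlib

namespace EpsID

section Expressions

/-! ### The Skolemized language

`L` collects the symbols of the language of arithmetic other than `0`, `S` and `=`, which are built
in; their standard interpretation is an instance `L.Structure ℕ`. -/

mutual
/-- Terms of `ℒ_ε` in the variables `0, …, n-1` in which no closed term occurs, that is, every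
subterm contains a variable. A Skolem function is given by its index, the simple formula
`φ(x, y₁, …, y_k)` of `∃x φ(x, y₁, …, y_k)`; the variable `x` is the variable number `0`. -/
inductive OTm (L : FirstOrder.Language.{0, 0}) : ℕ → Type
  | var {n : ℕ} (i : Fin n) : OTm L n
  | succ {n : ℕ} (t : OTm L n) : OTm L n
  | func {n k : ℕ} (f : L.Functions (k + 1)) (ts : Fin (k + 1) → OTm L n) : OTm L n
  | sk {n k : ℕ} (φ : SFm L (k + 2)) (ts : Fin (k + 1) → OTm L n) : OTm L n
/-- The simple quantifier-free formulas of `ℒ_ε` (those without closed terms) in the variables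
`0, …, n-1`. The atom `mem t` is `t ∈ I`. -/
inductive SFm (L : FirstOrder.Language.{0, 0}) : ℕ → Type
  | eq {n : ℕ} (s t : OTm L n) : SFm L n
  | rel {n k : ℕ} (R : L.Relations k) (ts : Fin k → OTm L n) : SFm L n
  | mem {n : ℕ} (t : OTm L n) : SFm L n
  | not {n : ℕ} (φ : SFm L n) : SFm L n
  | and {n : ℕ} (φ ψ : SFm L n) : SFm L n
  | or {n : ℕ} (φ ψ : SFm L n) : SFm L n
end

/-- The closed terms of `ℒ_ε`. -/
inductive CTm (L : FirstOrder.Language.{0, 0}) : Type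
  | zero : CTm L
  | succ (t : CTm L) : CTm L
  | func {k : ℕ} (f : L.Functions k) (ts : Fin k → CTm L) : CTm L
  | sk {k : ℕ} (φ : SFm L (k + 1)) (ts : Fin k → CTm L) : CTm L

/-- The closed formulas of `ℒ_ε`. -/
inductive CFm (L : FirstOrder.Language.{0, 0}) : Type
  | eq (s t : CTm L) : CFm L
  | rel {k : ℕ} (R : L.Relations k) (ts : Fin k → CTm L) : CFm L
  | mem (t : CTm L) : CFm L
  | not (φ : CFm L) : CFm L
  | and (φ ψ : CFm L) : CFm L
  | or (φ ψ : CFm L) : CFm L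

variable {L : FirstOrder.Language.{0, 0}}

mutual
/-- Simple rank: the least `n` such that the expression belongs to `ℒ_n`. A Skolem function
belongs to `ℒ_{n+1}` exactly if its index belongs to `ℒ_n`. -/
def OTm.rkS {n : ℕ} : OTm L n → ℕ
  | .var _ => 0
  | .succ t => t.rkS
  | .func _ ts => Finset.univ.sup fun i => (ts i).rkS
  | .sk φ ts => max (φ.rkS + 1) (Finset.univ.sup fun i => (ts i).rkS)
/-- Simple rank of a simple formula. -/
def SFm.rkS {n : ℕ} : SFm L n → ℕ
  | .eq s t => max s.rkS t.rkS
  | .rel _ ts => Finset.univ.sup fun i => (ts i).rkS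
  | .mem t => t.rkS
  | .not φ => φ.rkS
  | .and φ ψ => max φ.rkS ψ.rkS
  | .or φ ψ => max φ.rkS ψ.rkS
end

mutual
/-- The term contains the predicate `I`, possibly inside the index of a Skolem function. -/
def OTm.HasI {n : ℕ} : OTm L n → Prop
  | .var _ => False
  | .succ t => t.HasI
  | .func _ ts => ∃ i, (ts i).HasI
  | .sk φ ts => φ.HasI ∨ ∃ i, (ts i).HasI
/-- The formula contains the predicate `I`, possibly inside the index of a Skolem function. -/
def SFm.HasI {n : ℕ} : SFm L n → Prop
  | .eq s t => s.HasI ∨ t.HasI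
  | .rel _ ts => ∃ i, (ts i).HasI
  | .mem _ => True
  | .not φ => φ.HasI
  | .and φ ψ => φ.HasI ∨ ψ.HasI
  | .or φ ψ => φ.HasI ∨ ψ.HasI
end

/-- `SFm.Polar true φ`: the atoms `t ∈ I` of `φ` all occur positively; `SFm.Polar false φ`: they
all occur negatively. -/
def SFm.Polar : {n : ℕ} → Bool → SFm L n → Prop
  | _, _, .eq _ _ => True
  | _, _, .rel _ _ => True
  | _, b, .mem _ => b = true
  | _, b, .not φ => SFm.Polar (!b) φ
  | _, b, .and φ ψ => SFm.Polar b φ ∧ SFm.Polar b ψ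
  | _, b, .or φ ψ => SFm.Polar b φ ∧ SFm.Polar b ψ

/-- Substitution of terms for the variables. -/
def OTm.subst {n m : ℕ} (σ : Fin n → OTm L m) : OTm L n → OTm L m
  | .var i => σ i
  | .succ t => .succ (t.subst σ)
  | .func f ts => .func f fun i => (ts i).subst σ
  | .sk φ ts => .sk φ fun i => (ts i).subst σ

/-- Substitution of terms for the variables and of the formulas `ψ t` for the atoms `t ∈ I`. -/
def SFm.substI {n m : ℕ} (σ : Fin n → OTm L m) (ψ : OTm L m → SFm L m) : SFm L n → SFm L m
  | .eq s t => .eq (s.subst σ) (t.subst σ)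
  | .rel R ts => .rel R fun i => (ts i).subst σ
  | .mem t => ψ (t.subst σ)
  | .not φ => .not (φ.substI σ ψ)
  | .and φ χ => .and (φ.substI σ ψ) (χ.substI σ ψ)
  | .or φ χ => .or (φ.substI σ ψ) (χ.substI σ ψ)

/-- Substitution of terms for the variables of a formula. -/
def SFm.subst {n m : ℕ} (σ : Fin n → OTm L m) (φ : SFm L n) : SFm L m := φ.substI σ .mem

/-- Substitution of closed terms for all variables of a term. -/
def OTm.inst {n : ℕ} (s : Fin n → CTm L) : OTm L n → CTm L
  | .var i => s i
  | .succ t => .succ (t.inst s)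
  | .func f ts => .func f fun i => (ts i).inst s
  | .sk φ ts => .sk φ fun i => (ts i).inst s

/-- Substitution of closed terms for all variables of a formula. -/
def SFm.inst {n : ℕ} (s : Fin n → CTm L) : SFm L n → CFm L
  | .eq t u => .eq (t.inst s) (u.inst s)
  | .rel R ts => .rel R fun i => (ts i).inst s
  | .mem t => .mem (t.inst s)
  | .not φ => .not (φ.inst s)
  | .and φ ψ => .and (φ.inst s) (ψ.inst s)
  | .or φ ψ => .or (φ.inst s) (ψ.inst s)

/-- Implication, as an abbreviation. -/
def SFm.imp {n : ℕ} (φ ψ : SFm L n) : SFm L n := .or (.not φ) ψ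

/-- Implication, as an abbreviation. -/
def CFm.imp (φ ψ : CFm L) : CFm L := .or (.not φ) ψ

/-- The numeral `S⋯S0`. -/
def CTm.num : ℕ → CTm L
  | 0 => .zero
  | n + 1 => .succ (CTm.num n)

/-- A true formula. -/
def CFm.top : CFm L := .eq .zero .zero

/-- Finite conjunction. -/
def CFm.conj (l : List (CFm L)) : CFm L := l.foldr .and .top

/-- `∀x φ(x, y⃗)` with parameters `y⃗`, an abbreviation of `φ(c_{∃x ¬φ}(y⃗), y⃗)`. -/
def SFm.all {k : ℕ} (φ : SFm L (k + 2)) : SFm L (k + 1) :=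
  φ.subst (Fin.cons (.sk (.not φ) .var) .var)

/-- `∀x φ(x, s⃗)` with closed `s⃗`, an abbreviation of `φ(c_{∃x ¬φ}(s⃗), s⃗)`. -/
def SFm.allC {k : ℕ} (φ : SFm L (k + 1)) (s : Fin k → CTm L) : CFm L :=
  φ.inst (Fin.cons (.sk (.not φ) s) s)

/-- `∃x φ(x, s⃗)` with closed `s⃗`, an abbreviation of `φ(c_{∃x φ}(s⃗), s⃗)`. -/
def SFm.exC {k : ℕ} (φ : SFm L (k + 1)) (s : Fin k → CTm L) : CFm L :=
  φ.inst (Fin.cons (.sk φ s) s)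

/-- The formula `A(y, X) = ∀x B(x, y, X)` of the inductive definition, given by its quantifier-free
matrix `B` in the language of arithmetic with the extra predicate `X` (written as `I`).
The variable `x` has number `0`, the variable `y` has number `1`. -/
structure OpForm (L : FirstOrder.Language.{0, 0}) where
  B : SFm L 2
  noSkolem : B.rkS = 0
  positive : B.Polar true
  occurs : B.HasI

variable (O : OpForm L)

/-- The formula `A(y, I)`. -/
def OpForm.A : SFm L 1 := O.B.all

/-- The formula `B(z, x, φ)`, where `φ = φ(x, y⃗)`: its variable `0` is `z`, its variable `1` is `x`,
the others are `y⃗`. -/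
def OpForm.BAt {k : ℕ} (φ : SFm L (k + 1)) : SFm L (k + 2) :=
  O.B.substI ![.var 0, .var 1] fun t => φ.subst (Fin.cons t fun i => .var i.succ.succ)

/-- The formula `A(x, φ) = ∀z B(z, x, φ)`, where `φ = φ(x, y⃗)`. -/
def OpForm.AAt {k : ℕ} (φ : SFm L (k + 1)) : SFm L (k + 1) := (O.BAt φ).all

/-- The formula `A(x, φ) → φ(x)`. -/
def OpForm.step {k : ℕ} (φ : SFm L (k + 1)) : SFm L (k + 1) := (O.AAt φ).imp φ

/-- The formula `y = S x`, where `x` is the variable `0` and `y` the variable `1`. -/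
def predFm : SFm L 2 := .eq (.var 1) (.succ (.var 0))

/-- The formula `φ(x, y⃗) ∧ ¬ φ(S x, y⃗)`. -/
def indFm {k : ℕ} (φ : SFm L (k + 1)) : SFm L (k + 1) :=
  .and φ (.not (φ.subst (Fin.cons (.succ (.var 0)) fun i => .var i.succ)))

/-- Closed critical formulas, presented with the data that they are instances of. -/
inductive Crit (L : FirstOrder.Language.{0, 0}) : Type
  | pred (s : CTm L)
  | eps {k : ℕ} (φ : SFm L (k + 1)) (s : Fin k → CTm L) (t : CTm L)
  | ind {k : ℕ} (φ : SFm L (k + 1)) (s : Fin k → CTm L) (t : CTm L)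
  | indDef (t : CTm L)
  | closure {k : ℕ} (φ : SFm L (k + 1)) (s : Fin k → CTm L)

/-- The critical formula itself. -/
def Crit.fm : Crit L → CFm L
  | .pred s => .imp (.not (.eq s .zero)) (predFm.exC ![s])
  | .eps φ s t => .imp (φ.inst (Fin.cons t s)) (φ.exC s)
  | .ind φ s t =>
      .imp (.and (φ.inst (Fin.cons .zero s)) (.not (φ.inst (Fin.cons t s)))) ((indFm φ).exC s)
  | .indDef t => .imp (O.A.inst ![t]) (.mem t)
  | .closure φ s =>
      .imp ((O.step φ).allC s) ((SFm.imp (.mem (.var 0)) φ).allC s)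

end Expressions

section Substitutions

variable {L : FirstOrder.Language.{0, 0}}

/-! ### Canonical expressions, ranks, ε-substitutions -/

/-- Canonical terms `c_{∃x φ}(n₁, …, n_k)`. -/
structure CanTerm (L : FirstOrder.Language.{0, 0}) where
  k : ℕ
  body : SFm L (k + 1)
  args : Fin k → ℕ

/-- Canonical expressions: canonical terms, and the formulas `n ∈ I`. -/
inductive CExpr (L : FirstOrder.Language.{0, 0}) : Type
  | term (c : CanTerm L)
  | form (n : ℕ)

/-- Ranks: `inlₗ n` is the finite rank `n`, and `inrₗ n` is `Ω + n`. -/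
abbrev Rank := ℕ ⊕ₗ ℕ

/-- The rank `Ω`. -/
def Ω : Rank := Sum.inrₗ 0

/-- The canonical term `c_n = c_{∃x ¬B(x,y,I)}(n)`. -/
def OpForm.cTerm (O : OpForm L) (n : ℕ) : CanTerm L := ⟨1, .not O.B, ![n]⟩

/-- The canonical expression `c_n`. -/
def OpForm.c (O : OpForm L) (n : ℕ) : CExpr L := .term (O.cTerm n)

open Classical in
/-- The rank of a canonical expression. -/
noncomputable def CExpr.rk (O : OpForm L) : CExpr L → Rank
  | .form _ => Ω
  | .term c =>
      if ∃ n, c = O.cTerm n then Ω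
      else if c.body.HasI then Sum.inrₗ (c.body.rkS + 1 + 1)
      else Sum.inlₗ (c.body.rkS + 1)

/-- The possible values of an ε-substitution: `?`, a positive numeral, or `⊤`. -/
inductive Val
  | unk
  | num (u : ℕ+)
  | top

/-- Partial functions from canonical expressions to values. -/
abbrev Subst (L : FirstOrder.Language.{0, 0}) := CExpr L → Option Val

namespace Subst

variable (S : Subst L)

/-- The values of terms are `?` or positive numerals, the values of formulas are `?` or `⊤`. -/
def IsEpsSubst : Prop :=
  (∀ c, S (.term c) ≠ some .top) ∧ ∀ n u, S (.form n) ≠ some (.num u)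

/-- The domain. -/
def dom : Set (CExpr L) := {e | (S e).isSome}

open Classical in
/-- The set of those pairs in `S` which satisfy `p`. -/
noncomputable def filter (p : CExpr L → Val → Prop) : Subst L := fun e =>
  match S e with
  | some u => if p e u then some u else none
  | none => none

open Classical in
/-- The substitution `S` with the value at `e` set to `u`. -/
noncomputable def set (e : CExpr L) (u : Val) : Subst L := Function.update S e (some u)

/-- The union of two substitutions (used where they agree on the common domain). -/
def union (T : Subst L) : Subst L := fun e => (S e).or (T e)

/-- The standard extension: everything undefined gets the value `?`. -/
def ext : Subst L := fun e => some ((S e).getD .unk)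

end Subst

open Classical in
/-- All entries of a finite sequence, if all of them are defined. -/
noncomputable def seqOpt {α : Type} {k : ℕ} (f : Fin k → Option α) : Option (Fin k → α) :=
  if h : ∀ i, (f i).isSome then some fun i => (f i).get (h i) else none

/-- The number which a value stands for: `?` stands for `0`. -/
def Val.toNat? : Val → Option ℕ
  | .unk => some 0
  | .num u => some u
  | .top => none

/-- The truth value which a value stands for: `?` stands for falsity. -/
def Val.toBool? : Val → Option Bool
  | .unk => some false
  | .num _ => none
  | .top => some true

variable [L.Structure ℕ]

/-- `t.eval S = some n` if the reduction `|t|_S` is the numeral `n`; `t.eval S = none` if `|t|_S` is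
not a numeral. -/
noncomputable def CTm.eval (S : Subst L) : CTm L → Option ℕ
  | .zero => some 0
  | .succ t => (t.eval S).map Nat.succ
  | .func f ts => (seqOpt fun i => (ts i).eval S).map (FirstOrder.Language.Structure.funMap f)
  | .sk φ ts =>
      (seqOpt fun i => (ts i).eval S).bind fun a => (S (.term ⟨_, φ, a⟩)).bind Val.toNat?

open Classical in
/-- `φ.eval S = some b` if the reduction `|φ|_S` is a sentence of the language of arithmetic, with
truth value `b` in the standard model; otherwise `φ.eval S = none`. -/
noncomputable def CFm.eval (S : Subst L) : CFm L → Option Bool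
  | .eq s t => (s.eval S).bind fun a => (t.eval S).map fun b => decide (a = b)
  | .rel R ts =>
      (seqOpt fun i => (ts i).eval S).map fun a => decide (FirstOrder.Language.Structure.RelMap R a)
  | .mem t => (t.eval S).bind fun n => (S (.form n)).bind Val.toBool?
  | .not φ => (φ.eval S).map fun a => !a
  | .and φ ψ => (φ.eval S).bind fun a => (ψ.eval S).map fun b => a && b
  | .or φ ψ => (φ.eval S).bind fun a => (ψ.eval S).map fun b => a || b

/-- `S ⊨ φ`. -/
def Subst.Sat (S : Subst L) (φ : CFm L) : Prop := φ.eval S = some true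

/-- `S` decides `φ`. -/
def Subst.Decides (S : Subst L) (φ : CFm L) : Prop := S.Sat φ ∨ S.Sat (.not φ)

variable (O : OpForm L)

/-- The formula `F(e, u)`, which justifies the value `u` of `e`. -/
def FFm : CExpr L → Val → CFm L
  | .term c, .num u =>
      .and (c.body.inst (Fin.cons (.num u) fun i => .num (c.args i)))
        (.conj ((List.range (u : ℕ)).map fun v =>
          .not (c.body.inst (Fin.cons (.num v) fun i => .num (c.args i)))))
  | .form n, .top => O.A.inst ![.num n]
  | _, _ => .top

/-- `S` is correct. -/
def Subst.Correct (S : Subst L) : Prop := ∀ e u, S e = some u → S.ext.Sat (FFm O e u)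

/-- `S` is computationally inconsistent. -/
def Subst.Inconsistent (S : Subst L) : Prop :=
  (∃ e u, S e = some u ∧ S.Sat (.not (FFm O e u))) ∨
    ∃ n u, S (O.c n) = some (.num u) ∧ S (.form n) = some .top

/-- `S` decides `F(c, u)` for all pairs `(c, u)` in `S` such that `c` is a term. -/
def Subst.Computing (S : Subst L) : Prop :=
  ∀ c u, S (.term c) = some u → S.Decides (FFm O (.term c) u)

/-- `S` is solving, for the list `Cr` of critical formulas. -/
def Subst.Solving {N : ℕ} (Cr : Fin (N + 1) → Crit L) (S : Subst L) : Prop :=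
  ∀ i, S.ext.Sat ((Cr i).fm O)

/-- The negative part of rank `Ω`: pairs `(c_n, u)` with `u ≠ ?`, and pairs `(n ∈ I, ?)`. -/
noncomputable def Subst.negΩ (S : Subst L) : Subst L :=
  S.filter fun e u => e.rk O = Ω ∧ match e with
    | .term _ => u ≠ .unk
    | .form _ => u = .unk

/-- The positive part of rank `Ω`: pairs `(c_n, ?)`, and pairs `(n ∈ I, ⊤)`. -/
noncomputable def Subst.posΩ (S : Subst L) : Subst L :=
  S.filter fun e u => e.rk O = Ω ∧ match e with
    | .term _ => u = .unk
    | .form _ => u = .top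

end Substitutions

section Sequents

variable {L : FirstOrder.Language.{0, 0}}

/-! ### Histories and sequents -/

/-- The data of a sequent `(S, P, V, F)`; an entry `n` of `P` is the formula `n ∈ I`. The values
`t`, `f` of `F` are `true` (temporary), `false` (fixed). -/
@[ext]
structure Sequent (L : FirstOrder.Language.{0, 0}) where
  S : Subst L
  P : List ℕ
  V : ℕ → Option (Subst L)
  F : CExpr L → Option Bool

/-- Conditions on the values `V(n ∈ I)` in a substitution history: finite ε-substitutions that
consist of negative expressions of rank `Ω`. -/
def IsRecord (O : OpForm L) (T : Subst L) : Prop :=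
  T.IsEpsSubst ∧ T.dom.Finite ∧ T.negΩ O = T

/-- The data form a sequent: `S` is an ε-substitution, `(P, V)` is a substitution history, `P`
enumerates the formulas with value `⊤`, and `F` is defined exactly on the expressions in the domain
of `S` which have value `?` or rank `Ω`. All rules below, read upwards from a sequent with finite
`S`, lead to such sequents again. -/
structure Sequent.IsSequent (O : OpForm L) (Θ : Sequent L) : Prop where
  eps : Θ.S.IsEpsSubst
  nodup : Θ.P.Nodup
  history : ∀ n, n ∈ Θ.P ↔ Θ.S (.form n) = some .top
  domV : ∀ n, (Θ.V n).isSome ↔ n ∈ Θ.P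
  record : ∀ n T, Θ.V n = some T → IsRecord O T
  domF : ∀ e, (Θ.F e).isSome ↔ ∃ u, Θ.S e = some u ∧ (u = .unk ∨ e.rk O = Ω)

/-- The empty sequent. -/
def Sequent.empty : Sequent L := ⟨fun _ => none, [], fun _ => none, fun _ => none⟩

/-- The substitution `{(n ∈ I, ⊤) : n ∈ P}`. -/
def topSubst (P : List ℕ) : Subst L
  | .term _ => none
  | .form n => if n ∈ P then some .top else none

/-- The sequence `P` is admissible: `B(0, n, I)` is true for each entry `n`, if `I` is interpreted by
the set of the earlier entries. -/
def Admissible [L.Structure ℕ] (O : OpForm L) (P : List ℕ) : Prop :=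
  ∀ P₁ n P₂, P = P₁ ++ n :: P₂ →
    (topSubst P₁ : Subst L).ext.Sat (O.B.inst ![.num 0, .num n])

/-- The sequent `(e, u), Θ`. -/
noncomputable def Sequent.addVal (e : CExpr L) (u : ℕ+) (Θ : Sequent L) : Sequent L :=
  { Θ with S := Θ.S.set e (.num u) }

open Classical in
/-- The sequent `(e, ?, i), Θ`. -/
noncomputable def Sequent.addUnk (e : CExpr L) (i : Bool) (Θ : Sequent L) : Sequent L :=
  { Θ with S := Θ.S.set e .unk, F := Function.update Θ.F e (some i) }

open Classical in
/-- The sequent `(e, u, i), Θ`, for a term `e` of rank `Ω`. -/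
noncomputable def Sequent.addValΩ (e : CExpr L) (u : ℕ+) (i : Bool) (Θ : Sequent L) : Sequent L :=
  { Θ with S := Θ.S.set e (.num u), F := Function.update Θ.F e (some i) }

/-- `Q` is proper for `n ∈ I, Θ`. The entries of `Q` have no value in `Θ` yet, so that the union in
the definition of `(n ∈ I, ⊤, i, Q, W), Θ` is a function. -/
structure Proper [L.Structure ℕ] (O : OpForm L) (Θ : Sequent L) (n : ℕ) (Q : List ℕ) : Prop where
  nodup : Q.Nodup
  unk : ∀ m ∈ Q, ∀ u, Θ.S (O.c m) = some u → u = .unk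
  admissible : Admissible O (Θ.P ++ Q)
  last : Q.getLast? = some n
  disjoint : List.Disjoint Θ.P Q
  fresh : ∀ m ∈ Q, Θ.S (.form m) = none

/-- The sequent `(n ∈ I, ⊤, i, Q, W), Θ`, where `n` is the last entry of `Q`. -/
def Sequent.addTop (i : Bool) (Q : List ℕ) (W : ℕ → Option (Subst L)) (Θ : Sequent L) :
    Sequent L where
  S := Subst.union (topSubst Q) Θ.S
  P := Θ.P ++ Q
  V := fun m => (Θ.V m).or (W m)
  F := fun e => match e with
    | .form m => if m ∈ Q then some i else Θ.F e
    | .term _ => Θ.F e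

end Sequents

section HStep

variable {L : FirstOrder.Language.{0, 0}} [L.Structure ℕ] (O : OpForm L)

/-! ### The `H`-step, computed inside `S` -/

/-- `P₁` is the part of `P` before the first `n` such that `φ(n, s⃗)` is false. -/
def FirstFail (S : Subst L) (P : List ℕ) {k : ℕ} (φ : SFm L (k + 1)) (s : Fin k → CTm L)
    (n : ℕ) : Prop :=
  ∃ P₁ P₂, P = P₁ ++ n :: P₂ ∧ (∀ m ∈ P₁, S.Sat (φ.inst (Fin.cons (.num m) s))) ∧
    S.Sat (.not (φ.inst (Fin.cons (.num n) s)))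

/-- For a critical formula which is false under `S`, the pair of the expression `e` and the value `v`
which would make it true, all calculations taking place in `S`. -/
inductive HPair (S : Subst L) (P : List ℕ) : Crit L → CExpr L → Val → Prop
  | pred (s : CTm L) (n : ℕ) (v : ℕ+) (hs : s.eval S = some n) (hv : (v : ℕ) = n - 1) :
      HPair S P (.pred s) (.term ⟨1, predFm, ![n]⟩) (.num v)
  | eps {k : ℕ} (φ : SFm L (k + 1)) (s : Fin k → CTm L) (t : CTm L) (a : Fin k → ℕ) (v : ℕ+)
      (hs : ∀ i, (s i).eval S = some (a i)) (ht : t.eval S = some (v : ℕ)) :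
      HPair S P (.eps φ s t) (.term ⟨k, φ, a⟩) (.num v)
  | ind {k : ℕ} (φ : SFm L (k + 1)) (s : Fin k → CTm L) (t : CTm L) (a : Fin k → ℕ) (n : ℕ)
      (v : ℕ+) (hs : ∀ i, (s i).eval S = some (a i)) (ht : t.eval S = some n) (hvn : (v : ℕ) < n)
      (h : S.Sat (φ.inst (Fin.cons (.num v) s)))
      (h' : S.Sat (.not (φ.inst (Fin.cons (.num (v + 1)) s))))
      (least : ∀ m < (v : ℕ), S.Sat (.not (.and (φ.inst (Fin.cons (.num m) s))
        (.not (φ.inst (Fin.cons (.num (m + 1)) s)))))) :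
      HPair S P (.ind φ s t) (.term ⟨k, indFm φ, a⟩) (.num v)
  | indDef (t : CTm L) (n : ℕ) (ht : t.eval S = some n) :
      HPair S P (.indDef t) (.form n) .top
  | closureNeg {k : ℕ} (φ : SFm L (k + 1)) (s : Fin k → CTm L) (a : Fin k → ℕ) (n : ℕ) (v : ℕ+)
      (hs : ∀ i, (s i).eval S = some (a i)) (hn : FirstFail S P φ s n)
      (hA : S.Sat (.not ((O.AAt φ).inst (Fin.cons (.num n) s))))
      (hv : S (.term ⟨k + 1, .not (O.BAt φ), Fin.cons n a⟩) = some (.num v)) :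
      HPair S P (.closure φ s) (O.c n) (.num v)
  | closurePos {k : ℕ} (φ : SFm L (k + 1)) (s : Fin k → CTm L) (a : Fin k → ℕ) (v : ℕ+)
      (hs : ∀ i, (s i).eval S = some (a i)) (hn : FirstFail S P φ s v)
      (hA : S.Sat ((O.AAt φ).inst (Fin.cons (.num v) s))) :
      HPair S P (.closure φ s) (.term ⟨k, .not (O.step φ), a⟩) (.num v)

variable {N : ℕ} (Cr : Fin (N + 1) → Crit L)

/-- The `H`-step applies to a sequent with components `S`, `P`, with `H`-expression `e` and
`H`-value `v`: `S` is correct and nonsolving, and all calculations take place in `S`. Among the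
critical formulas that are false, the one with number `i` is used, which has an expression of least
rank, and the least number among those. -/
structure HApplies (S : Subst L) (P : List ℕ) (e : CExpr L) (v : Val) : Prop where
  correct : S.Correct O
  nonsolving : ¬ S.Solving O Cr
  computing : S.Computing O
  decides : ∀ i, S.Decides ((Cr i).fm O)
  pairs : ∀ i, S.Sat (.not ((Cr i).fm O)) → ∃ e' v', HPair O S P (Cr i) e' v'
  main : ∃ i, S.Sat (.not ((Cr i).fm O)) ∧ HPair O S P (Cr i) e v ∧
    ∀ j e' v', S.Sat (.not ((Cr j).fm O)) → HPair O S P (Cr j) e' v' →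
      e.rk O < e'.rk O ∨ (e.rk O = e'.rk O ∧ i ≤ j)
  unk : S e = some .unk
  term : ∀ n, e = O.c n → (S (.form n)).isSome
  form : ∀ n, e = .form n → (S (O.c n)).isSome
  conflict : ∀ n m, e = O.c n → S (O.c m) = some .unk → (S (.form m)).isSome

open Classical in
/-- The components `S`, `P`, `V` of `H(Θ)`, for the `H`-expression `e` and the `H`-value `v`. -/
noncomputable def hData (e : CExpr L) (v : Val) (Θ : Sequent L) :
    Subst L × List ℕ × (ℕ → Option (Subst L)) :=
  if Ω < e.rk O then
    ((Θ.S.filter fun e' _ => e'.rk O ≤ e.rk O).set e v, Θ.P, Θ.V)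
  else if e.rk O < Ω then
    ((Θ.S.filter fun e' _ => e'.rk O ≤ e.rk O).set e v, [], fun _ => none)
  else match e with
    | .form n =>
        ((Subst.union (Θ.S.filter fun e' _ => e'.rk O < Ω) (Θ.S.posΩ O)).set e v,
          Θ.P ++ [n], Function.update Θ.V n (some (Θ.S.negΩ O)))
    | .term c =>
        let n : ℕ := if h : ∃ n, c = O.cTerm n then h.choose else 0
        let P' : List ℕ := Θ.P.takeWhile fun m => m ≠ n
        let S' : Subst L := Θ.S.filter fun e' u => ∃ m ∈ P',
          (e' = O.c m ∧ u = .unk) ∨ (e' = .form m ∧ u = .top)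
        let V' : Subst L := if n ∈ Θ.P then (Θ.V n).getD fun _ => none else Θ.S.negΩ O
        ((Subst.union (Θ.S.filter fun e' _ => e'.rk O < Ω) (Subst.union S' V')).set e v,
          P', fun m => if m ∈ P' then Θ.V m else none)

open Classical in
/-- The sequent `H(Θ)`. Expressions which are new in `H(Θ)` are temporary. -/
noncomputable def hSeq (e : CExpr L) (v : Val) (Θ : Sequent L) : Sequent L where
  S := (hData O e v Θ).1
  P := (hData O e v Θ).2.1
  V := (hData O e v Θ).2.2
  F := fun e' =>
    match (hData O e v Θ).1 e' with
    | none => none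
    | some u => if u = .unk ∨ e'.rk O = Ω then some ((Θ.F e').getD true) else none

/-- `e'` is active at `Θ`, where `e` is the `H`-expression and `v` the `H`-value. -/
def Active (e : CExpr L) (v : Val) (Θ : Sequent L) (e' : CExpr L) : Prop :=
  e' ∈ Θ.S.dom ∧ e'.rk O = e.rk O ∧ (hSeq O e v Θ).S e' ≠ Θ.S e'

end HStep

section Deductions

variable {L : FirstOrder.Language.{0, 0}} [L.Structure ℕ] (O : OpForm L) {N : ℕ} (Cr : Fin (N + 1) → Crit L)

/-! ### The deduction system -/

/-- The axioms. -/
inductive IsAxiom (Θ : Sequent L) : Prop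
  | axF (h : Θ.S.Inconsistent O)
  | axS (h : Θ.S.Solving O Cr) (h' : ∀ i, Θ.S.Decides ((Cr i).fm O))
  | axH (e : CExpr L) (v : Val) (h : HApplies O Cr Θ.S Θ.P e v) (e' : CExpr L)
      (active : Active O e v Θ e') (fixed : Θ.F e' = some false)

/-- The kinds of rules; the variants of `Cut` and `CutFr` at rank `Ω` are of the same kind. -/
inductive Kind
  | cut
  | cutFr
  | fr
  | h

/-- `Inference O Cr X e Θ Pr`: there is an inference by a rule of kind `X` with main expression `e`,
with conclusion `Θ` and set of premises `Pr`. -/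
inductive Inference : Kind → CExpr L → Sequent L → Set (Sequent L) → Prop
  | cut (c : CanTerm L) (Θ : Sequent L) (hr : (CExpr.term c).rk O ≠ Ω)
      (hc : .term c ∉ Θ.S.dom) :
      Inference .cut (.term c) Θ
        ({Θ.addUnk (.term c) false} ∪ Set.range fun u : ℕ+ => Θ.addVal (.term c) u)
  | cutFr (c : CanTerm L) (Θ : Sequent L) (hr : (CExpr.term c).rk O ≠ Ω)
      (hc : .term c ∉ Θ.S.dom) :
      Inference .cutFr (.term c) Θ
        ({Θ.addUnk (.term c) true} ∪ Set.range fun u : ℕ+ => Θ.addVal (.term c) u)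
  | cutTerm (c : CanTerm L) (Θ : Sequent L) (hr : (CExpr.term c).rk O = Ω)
      (hc : .term c ∉ Θ.S.dom) :
      Inference .cut (.term c) Θ
        ({Θ.addUnk (.term c) false} ∪ Set.range fun u : ℕ+ => Θ.addValΩ (.term c) u false)
  | cutFrTerm (c : CanTerm L) (Θ : Sequent L) (hr : (CExpr.term c).rk O = Ω)
      (hc : .term c ∉ Θ.S.dom) :
      Inference .cutFr (.term c) Θ
        ({Θ.addUnk (.term c) true} ∪ Set.range fun u : ℕ+ => Θ.addValΩ (.term c) u false)
  | cutForm (n : ℕ) (Θ : Sequent L) (hn : .form n ∉ Θ.S.dom) :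
      Inference .cut (.form n) Θ
        ({Θ.addUnk (.form n) false} ∪
          {Θ' | ∃ (Q : List ℕ) (W : ℕ → Option (Subst L)), Proper O Θ n Q ∧
            (∀ m, (W m).isSome ↔ m ∈ Q) ∧ (∀ m T, W m = some T → IsRecord O T) ∧
            Θ' = Θ.addTop false Q W})
  | fr (e : CExpr L) (Θ : Sequent L) (he : e ∉ Θ.S.dom) :
      Inference .fr e Θ {Θ.addUnk e true}
  | h (e : CExpr L) (v : Val) (Θ : Sequent L) (happ : HApplies O Cr Θ.S Θ.P e v)
      (temp : ∀ e', Active O e v Θ e' → Θ.F e' = some true) :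
      Inference .h e Θ {hSeq O e v Θ}

/-- Deductions from the set `𝒮` of sequents: well-founded trees. -/
inductive Deduction (𝒮 : Set (Sequent L)) : Sequent L → Type
  | hyp (Θ : Sequent L) (h : Θ ∈ 𝒮) : Deduction 𝒮 Θ
  | ax (Θ : Sequent L) (h : IsAxiom O Cr Θ) : Deduction 𝒮 Θ
  | inf (X : Kind) (e : CExpr L) (Θ : Sequent L) (Pr : Set (Sequent L))
      (h : Inference O Cr X e Θ Pr) (d : ∀ Θ' ∈ Pr, Deduction 𝒮 Θ') : Deduction 𝒮 Θ

/-- Derivations: deductions from the empty set. -/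
abbrev Derivation (Θ : Sequent L) : Type := Deduction O Cr ∅ Θ

variable {O Cr}

/-- The main expression of every application of a rule of kind `X` in the deduction has a rank
satisfying `p`. -/
def Deduction.Ranks {𝒮 : Set (Sequent L)} (X : Kind) (p : Rank → Prop) :
    {Θ : Sequent L} → Deduction O Cr 𝒮 Θ → Prop
  | _, .hyp _ _ => True
  | _, .ax _ _ => True
  | _, .inf Y e _ Pr _ d =>
      (Y = X → p (e.rk O)) ∧ ∀ Θ' (h : Θ' ∈ Pr), (d Θ' h).Ranks X p

/-- The deduction is an `r`-deduction: `Cut(d) < r`, `CutFr(d) < 0`, `Fr(d) ≥ r`, `H(d) ≥ r`. -/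
structure Deduction.IsRDeduction (r : Rank) {𝒮 : Set (Sequent L)} {Θ : Sequent L}
    (d : Deduction O Cr 𝒮 Θ) : Prop where
  cut : d.Ranks .cut (· < r)
  cutFr : d.Ranks .cutFr (· < Sum.inlₗ 0)
  fr : d.Ranks .fr (r ≤ ·)
  h : d.Ranks .h (r ≤ ·)

variable (O Cr)

/-- `Θ'` is a premise of an inference with conclusion `Θ`, by an `H` or `Fr` rule of rank `≥ Ω` or a
`Cut` rule of rank `≤ r`. -/
def PathStep (r : Rank) (Θ Θ' : Sequent L) : Prop :=
  ∃ X e Pr, Inference O Cr X e Θ Pr ∧ Θ' ∈ Pr ∧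
    match X with
    | .cut => e.rk O ≤ r
    | .cutFr => False
    | .fr => Ω ≤ e.rk O
    | .h => Ω ≤ e.rk O

/-- There is a path `∅ = Θ₀, …, Θ_n = Θ` that consists of `H` and `Fr` rules of rank `≥ Ω` and of
`Cut` rules of rank `≤ r`. -/
def HasPath (r : Rank) (Θ : Sequent L) : Prop :=
  ∃ (n : ℕ) (Θs : ℕ → Sequent L), Θs 0 = Sequent.empty ∧ Θs n = Θ ∧
    ∀ i < n, PathStep O Cr r (Θs i) (Θs (i + 1))

end Deductions

end EpsID

-- For `r = Ω` nothing is to be proved. For a finite rank `n` the core is the elimination of cuts of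
-- rank exactly `n`, which turns an `(n+1)`-derivation into an `n`-derivation (`RDer.reduce`). A
-- `Cut` of rank `n` is replaced by a `Fr` rule on the same expression `e`: only the premise with
-- value `?` is kept, and the label of `e` changes from fixed to temporary. This damages only those
-- axioms `AxH` whose `H`-expression is `e`; they become `H` rules of rank `n`, whose premises give
-- `e` a numerical value `v` and have to be derived from the premise `(e, v)` of the original `Cut`.
--
-- That `H` rule keeps the accumulated values of rank at most `n` but erases everything above,
-- including the history. Cuts of rank less than `n` first decide the formula `F(e, v)`
-- (`Enforces.decides`); if it is false, the sequent is an axiom `AxF`. If it is true, the path from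
-- the empty sequent to the conclusion of the `Cut` is replayed over the current low part
-- (`Path.rder`): its `Fr` and `H` rules have rank above `n` and rebuild the erased part, while its
-- `Cut` rules add only values already present. This leads to the premise `(e, v)`, with a richer
-- low part.
--
-- The induction therefore needs an arbitrary low part. `Sequent.comb` takes the values of rank at
-- most `n` from `X` and everything else from `Ψ`, and `RDer.rder_comb` derives all such
-- combinations by induction on the derivation of `Ψ`. The invariant `Replaces` requires `X` to
-- extend the low part of `Ψ`, its additional values to be justified, and each temporary expression
-- occurring in `Ψ` to be `Revisable`. The last condition stores the induction hypotheses for the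
-- numerical premises of the cuts already replaced, so that they are available at the axioms above
-- (`Path.revisable_addUnk`, `Replaces.rder_of_isAxiom`).
--
-- An `H`-step of rank above `n` stays applicable with the same expression and value after such a
-- replacement: all calculations took place in `Ψ`, and the values of rank `Ω` are untouched
-- (`Fits.happlies`, `hSeq_comb`).
--
-- Finally, an `Ω`-derivation may use cuts of unboundedly many finite ranks. `RDer.reduce_of_Ω`
-- proceeds by induction on the tree, with the target rank `n` varying, and applies the reduction
-- finitely often at each cut of rank at least `n`.

namespace EpsID

-- Evaluation of expressions and its dependence on the substitution

section Evaluation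

variable {L : FirstOrder.Language.{0, 0}}

/-- Every Skolem function symbol of the closed term has an index that satisfies `p`. -/
def CTm.All (p : ∀ k, SFm L (k + 1) → Prop) : CTm L → Prop
  | .zero => True
  | .succ t => t.All p
  | .func _ ts => ∀ i, (ts i).All p
  | .sk φ ts => p _ φ ∧ ∀ i, (ts i).All p

/-- Every Skolem function symbol of the closed formula has an index that satisfies `p`; the
predicate `I` occurs outside the indices only if `q` holds. -/
def CFm.All (p : ∀ k, SFm L (k + 1) → Prop) (q : Prop) : CFm L → Prop
  | .eq s t => s.All p ∧ t.All p
  | .rel _ ts => ∀ i, (ts i).All p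
  | .mem t => q ∧ t.All p
  | .not φ => φ.All p q
  | .and φ ψ => φ.All p q ∧ ψ.All p q
  | .or φ ψ => φ.All p q ∧ ψ.All p q

theorem CTm.all_true (t : CTm L) : t.All fun _ _ => True := by
  induction t with
  | zero => trivial
  | succ t ih => exact ih
  | func f ts ih => exact ih
  | sk φ ts ih => exact ⟨trivial, ih⟩

theorem CFm.all_true (φ : CFm L) : φ.All (fun _ _ => True) True := by
  induction φ with
  | eq s t => exact ⟨s.all_true, t.all_true⟩
  | rel R ts => exact fun i => (ts i).all_true
  | mem t => exact ⟨trivial, t.all_true⟩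
  | not φ ih => exact ih
  | and φ ψ ih ih' => exact ⟨ih, ih'⟩
  | or φ ψ ih ih' => exact ⟨ih, ih'⟩

theorem CTm.all_num (p : ∀ k, SFm L (k + 1) → Prop) (n : ℕ) : (CTm.num n).All p := by
  induction n with
  | zero => trivial
  | succ n ih => exact ih

theorem seqOpt_eq_some {α : Type} {k : ℕ} {f : Fin k → Option α} {a : Fin k → α} :
    seqOpt f = some a ↔ ∀ i, f i = some (a i) := by
  unfold seqOpt
  split_ifs with h
  · rw [Option.some_inj]
    constructor
    · rintro rfl i
      simp
    · intro H
      funext i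
      simp [H]
  · simp only [false_iff]
    exact fun H => h fun i => by simp [H]

mutual
theorem OTm.inst_subst {n m : ℕ} (σ : Fin n → OTm L m) (s : Fin m → CTm L) :
    ∀ t : OTm L n, (t.subst σ).inst s = t.inst fun i => (σ i).inst s
  | .var _ => rfl
  | .succ t => by simp [OTm.subst, OTm.inst, OTm.inst_subst σ s t]
  | .func f ts => by
      simp only [OTm.subst, OTm.inst]
      congr 1
      funext i
      exact OTm.inst_subst σ s (ts i)
  | .sk φ ts => by
      simp only [OTm.subst, OTm.inst]
      congr 1
      funext i
      exact OTm.inst_subst σ s (ts i)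
end

theorem SFm.inst_subst : ∀ {n m : ℕ} (σ : Fin n → OTm L m) (s : Fin m → CTm L)
    (φ : SFm L n), (φ.subst σ).inst s = φ.inst fun i => (σ i).inst s
  | _, _, σ, s, .eq t u => by simp [SFm.subst, SFm.substI, SFm.inst, OTm.inst_subst]
  | _, _, σ, s, .rel R ts => by simp [SFm.subst, SFm.substI, SFm.inst, OTm.inst_subst]
  | _, _, σ, s, .mem t => by simp [SFm.subst, SFm.substI, SFm.inst, OTm.inst_subst]
  | _, _, σ, s, .not φ => by
      have := SFm.inst_subst σ s φ
      simp_all [SFm.subst, SFm.substI, SFm.inst]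
  | _, _, σ, s, .and φ ψ => by
      have := SFm.inst_subst σ s φ
      have := SFm.inst_subst σ s ψ
      simp_all [SFm.subst, SFm.substI, SFm.inst]
  | _, _, σ, s, .or φ ψ => by
      have := SFm.inst_subst σ s φ
      have := SFm.inst_subst σ s ψ
      simp_all [SFm.subst, SFm.substI, SFm.inst]

/-- The index is free of `I` and belongs to a language `ℒ_j` with `j < m`. -/
def LowIndex (m k : ℕ) (φ : SFm L (k + 1)) : Prop := φ.rkS + 1 ≤ m ∧ ¬ φ.HasI

theorem OTm.all_inst {n m : ℕ} {p : ∀ k, SFm L (k + 1) → Prop} (s : Fin n → CTm L)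
    (hp : ∀ k φ, LowIndex m k φ → p k φ) (hs : ∀ i, (s i).All p) :
    ∀ t : OTm L n, t.rkS ≤ m → (m = 0 ∨ ¬ t.HasI) → (t.inst s).All p
  | .var i, _, _ => hs i
  | .succ t, h, h' => OTm.all_inst s hp hs t h h'
  | .func f ts, h, h' => fun i => OTm.all_inst s hp hs (ts i)
      ((Finset.le_sup (f := fun i => (ts i).rkS) (Finset.mem_univ i)).trans h)
      (h'.imp_right fun h'' hi => h'' ⟨i, hi⟩)
  | .sk φ ts, h, h' => by
      simp only [OTm.rkS, max_le_iff] at h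
      refine ⟨hp _ _ ⟨h.1, fun hI => ?_⟩, fun i => OTm.all_inst s hp hs (ts i)
        ((Finset.le_sup (f := fun i => (ts i).rkS) (Finset.mem_univ i)).trans h.2)
        (h'.imp_right fun h'' hi => h'' (Or.inr ⟨i, hi⟩))⟩
      rcases h' with rfl | h'
      · omega
      · exact h' (Or.inl hI)

/-- The hypothesis covers two situations: formulas free of `I`, and formulas without Skolem
functions (`m = 0`), where atoms `t ∈ I` are harmless. -/
theorem SFm.all_inst {m : ℕ} {p : ∀ k, SFm L (k + 1) → Prop} {q : Prop}
    (hp : ∀ k φ, LowIndex m k φ → p k φ) :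
    ∀ {n : ℕ} (s : Fin n → CTm L) (_ : ∀ i, (s i).All p) (φ : SFm L n),
      φ.rkS ≤ m → (m = 0 ∧ q ∨ ¬ φ.HasI) → (φ.inst s).All p q
  | _, s, hs, .eq t u, h, h' => by
      simp only [SFm.rkS, max_le_iff] at h
      simp only [SFm.HasI] at h'
      exact ⟨OTm.all_inst s hp hs t h.1 (by tauto), OTm.all_inst s hp hs u h.2 (by tauto)⟩
  | _, s, hs, .rel R ts, h, h' => fun i => OTm.all_inst s hp hs (ts i)
      ((Finset.le_sup (f := fun i => (ts i).rkS) (Finset.mem_univ i)).trans h)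
      (h'.imp And.left fun h'' hi => h'' ⟨i, hi⟩)
  | _, s, hs, .mem t, h, h' => by
      simp only [SFm.HasI, not_true, or_false] at h'
      exact ⟨h'.2, OTm.all_inst s hp hs t h (Or.inl h'.1)⟩
  | _, s, hs, .not φ, h, h' => SFm.all_inst hp s hs φ h h'
  | _, s, hs, .and φ ψ, h, h' => by
      simp only [SFm.rkS, max_le_iff] at h
      simp only [SFm.HasI] at h'
      exact ⟨SFm.all_inst hp s hs φ h.1 (by tauto), SFm.all_inst hp s hs ψ h.2 (by tauto)⟩
  | _, s, hs, .or φ ψ, h, h' => by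
      simp only [SFm.rkS, max_le_iff] at h
      simp only [SFm.HasI] at h'
      exact ⟨SFm.all_inst hp s hs φ h.1 (by tauto), SFm.all_inst hp s hs ψ h.2 (by tauto)⟩

theorem CFm.all_conj {p : ∀ k, SFm L (k + 1) → Prop} {q : Prop} (l : List (CFm L))
    (h : ∀ φ ∈ l, φ.All p q) : (CFm.conj l).All p q := by
  induction l with
  | nil => exact ⟨trivial, trivial⟩
  | cons φ l ih =>
    exact ⟨h φ (by simp), ih fun ψ hψ => h ψ (by simp [hψ])⟩

/-- The Skolem functions evaluated in `F(c, u)` are those of the body of `c`, so the canonical terms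
met there have smaller rank than `c`. This gap by one supports all inductions on finite ranks. -/
theorem FFm_term_all (O : OpForm L) (c : CanTerm L) (u : Val) (h : ¬ c.body.HasI) :
    (FFm O (.term c) u).All (LowIndex c.body.rkS) False := by
  have key : ∀ v : ℕ, (c.body.inst (Fin.cons (.num v) fun i => .num (c.args i))).All
      (LowIndex c.body.rkS) False := fun v =>
    SFm.all_inst (fun _ _ h => h) _
      (Fin.cases (CTm.all_num _ _) fun _ => CTm.all_num _ _) _ le_rfl (Or.inr h)
  cases u with
  | num u =>
    refine ⟨key u, CFm.all_conj _ fun φ hφ => ?_⟩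
    obtain ⟨v, -, rfl⟩ := List.mem_map.1 hφ
    exact key v
  | unk => exact ⟨trivial, trivial⟩
  | top => exact ⟨trivial, trivial⟩

/-- The Skolem functions of `A(n, I)` form canonical terms `c_m` only. -/
theorem A_inst_all (O : OpForm L) (n : ℕ) :
    (O.A.inst ![.num n]).All
      (fun k φ => ∀ a : Fin k → ℕ, ∃ m, (⟨k, φ, a⟩ : CanTerm L) = O.cTerm m) True := by
  have hc : ∀ a : Fin 1 → ℕ, ∃ m, (⟨1, .not O.B, a⟩ : CanTerm L) = O.cTerm m := fun a =>
    ⟨a 0, by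
      unfold OpForm.cTerm
      congr 1
      funext i
      rw [Subsingleton.elim i 0]
      rfl⟩
  have hv : ∀ i : Fin 1, ((![.num n] : Fin 1 → CTm L) i).All
      fun k φ => ∀ a : Fin k → ℕ, ∃ m, (⟨k, φ, a⟩ : CanTerm L) = O.cTerm m := fun i => by
    rw [Subsingleton.elim i 0]
    exact CTm.all_num _ n
  unfold OpForm.A SFm.all
  rw [SFm.inst_subst]
  -- `B` has no Skolem functions, so the only one in `A(n, I)` comes from the term substituted for
  -- the quantified variable.
  refine SFm.all_inst (m := 0) (fun k φ h => absurd h.1 (by omega)) _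
    (Fin.cases ?_ fun i => hv i) _ O.noSkolem.le (Or.inl ⟨rfl, trivial⟩)
  exact ⟨hc, hv⟩

/-- `S'` extends `S`. -/
def Subst.Le (S S' : Subst L) : Prop := ∀ e u, S e = some u → S' e = some u

theorem Subst.Le.refl (S : Subst L) : S.Le S := fun _ _ h => h

theorem Subst.Le.trans {S S' S'' : Subst L} (h : S.Le S') (h' : S'.Le S'') : S.Le S'' :=
  fun e u he => h' e u (h e u he)

theorem Subst.le_ext (S : Subst L) : S.Le S.ext := fun e u h => by simp [Subst.ext, h]

theorem Subst.set_self (S : Subst L) (e : CExpr L) (u : Val) : S.set e u e = some u := by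
  classical exact Function.update_self ..

theorem Subst.set_of_ne {e e' : CExpr L} (h : e' ≠ e) (S : Subst L) (u : Val) :
    S.set e u e' = S e' := by
  classical exact Function.update_of_ne h ..

theorem Subst.le_set {S : Subst L} {e : CExpr L} (he : S e = none) (u : Val) :
    S.Le (S.set e u) := fun e' v h => by
  rw [Subst.set_of_ne, h]
  rintro rfl
  simp [he] at h

variable [L.Structure ℕ]

theorem CTm.eval_mono {S S' : Subst L} {p : ∀ k, SFm L (k + 1) → Prop}
    (h : ∀ k φ a u, p k φ → S (.term ⟨k, φ, a⟩) = some u → S' (.term ⟨k, φ, a⟩) = some u)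
    (t : CTm L) (ht : t.All p) {n : ℕ} (hn : t.eval S = some n) : t.eval S' = some n := by
  induction t generalizing n with
  | zero => simpa [CTm.eval] using hn
  | succ t ih =>
    simp only [CTm.eval, Option.map_eq_some_iff] at hn ⊢
    obtain ⟨m, hm, rfl⟩ := hn
    exact ⟨m, ih ht hm, rfl⟩
  | func f ts ih =>
    simp only [CTm.eval, Option.map_eq_some_iff, seqOpt_eq_some] at hn ⊢
    obtain ⟨a, ha, rfl⟩ := hn
    exact ⟨a, fun i => ih i (ht i) (ha i), rfl⟩
  | sk φ ts ih =>
    simp only [CTm.eval, Option.bind_eq_some_iff, seqOpt_eq_some] at hn ⊢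
    obtain ⟨a, ha, u, hu, hn⟩ := hn
    exact ⟨a, fun i => ih i (ht.2 i) (ha i), u, h _ _ _ _ ht.1 hu, hn⟩

/-- The predicates `p` and `q` bound what the formula can consult. Taken trivially they give
monotonicity under extension; taken sharply they compare substitutions that agree only on a
fragment, such as rank `Ω`. -/
theorem CFm.eval_mono {S S' : Subst L} {p : ∀ k, SFm L (k + 1) → Prop} {q : Prop}
    (h : ∀ k φ a u, p k φ → S (.term ⟨k, φ, a⟩) = some u → S' (.term ⟨k, φ, a⟩) = some u)
    (h' : q → ∀ n u, S (.form n) = some u → S' (.form n) = some u)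
    (φ : CFm L) (hφ : φ.All p q) {b : Bool} (hb : φ.eval S = some b) : φ.eval S' = some b := by
  induction φ generalizing b with
  | eq s t =>
    simp only [CFm.eval, Option.bind_eq_some_iff, Option.map_eq_some_iff] at hb ⊢
    obtain ⟨m, hm, n, hn, rfl⟩ := hb
    exact ⟨m, s.eval_mono h hφ.1 hm, n, t.eval_mono h hφ.2 hn, rfl⟩
  | rel R ts =>
    simp only [CFm.eval, Option.map_eq_some_iff, seqOpt_eq_some] at hb ⊢
    obtain ⟨a, ha, rfl⟩ := hb
    exact ⟨a, fun i => (ts i).eval_mono h (hφ i) (ha i), rfl⟩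
  | mem t =>
    simp only [CFm.eval, Option.bind_eq_some_iff] at hb ⊢
    obtain ⟨n, hn, u, hu, hb⟩ := hb
    exact ⟨n, t.eval_mono h hφ.2 hn, u, h' hφ.1 _ _ hu, hb⟩
  | not φ ih =>
    simp only [CFm.eval, Option.map_eq_some_iff] at hb ⊢
    obtain ⟨a, ha, rfl⟩ := hb
    exact ⟨a, ih hφ ha, rfl⟩
  | and φ ψ ih ih' =>
    simp only [CFm.eval, Option.bind_eq_some_iff, Option.map_eq_some_iff] at hb ⊢
    obtain ⟨a, ha, c, hc, rfl⟩ := hb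
    exact ⟨a, ih hφ.1 ha, c, ih' hφ.2 hc, rfl⟩
  | or φ ψ ih ih' =>
    simp only [CFm.eval, Option.bind_eq_some_iff, Option.map_eq_some_iff] at hb ⊢
    obtain ⟨a, ha, c, hc, rfl⟩ := hb
    exact ⟨a, ih hφ.1 ha, c, ih' hφ.2 hc, rfl⟩

namespace Subst.Le

variable {S S' : Subst L} (hS : S.Le S')
include hS

theorem evalTm {t : CTm L} {n : ℕ} (h : t.eval S = some n) : t.eval S' = some n :=
  t.eval_mono (fun _ _ _ _ _ => hS _ _) t.all_true h

theorem evalFm {φ : CFm L} {b : Bool} (h : φ.eval S = some b) : φ.eval S' = some b :=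
  φ.eval_mono (fun _ _ _ _ _ => hS _ _) (fun _ _ => hS _) φ.all_true h

theorem sat {φ : CFm L} (h : S.Sat φ) : S'.Sat φ := hS.evalFm h

theorem decides {φ : CFm L} (h : S.Decides φ) : S'.Decides φ := h.imp hS.sat hS.sat

end Subst.Le

theorem Subst.sat_not_iff {S : Subst L} {φ : CFm L} : S.Sat (.not φ) ↔ φ.eval S = some false := by
  simp [Subst.Sat, CFm.eval]

theorem Subst.not_sat_of_sat_not {S : Subst L} {φ : CFm L} (h : S.Sat (.not φ)) : ¬ S.Sat φ := by
  rw [Subst.sat_not_iff] at h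
  simp [Subst.Sat, h]

theorem Subst.decides_iff {S : Subst L} {φ : CFm L} : S.Decides φ ↔ (φ.eval S).isSome := by
  unfold Subst.Decides
  rw [Subst.sat_not_iff, Subst.Sat]
  cases h : φ.eval S with
  | none => simp
  | some b => cases b <;> simp

theorem Subst.sat_top (S : Subst L) : S.Sat .top := by
  simp [Subst.Sat, CFm.top, CFm.eval, CTm.eval]

/-- Correctness concerns the standard extension, which is not monotone in `S`. A formula decided in
`S` keeps its truth value there, so truth descends to `S` itself, where monotonicity applies. -/
theorem Subst.sat_FFm {O : OpForm L} {S : Subst L} (h : S.Correct O) (h' : S.Computing O)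
    {c : CanTerm L} {u : Val} (hu : S (.term c) = some u) : S.Sat (FFm O (.term c) u) :=
  (h' c u hu).resolve_right fun hn =>
    Subst.not_sat_of_sat_not (S.le_ext.sat hn) (h _ _ hu)

end Evaluation

-- Stability of the `H`-step under extension of the substitution

section Pairs

variable {L : FirstOrder.Language.{0, 0}} [L.Structure ℕ] {O : OpForm L}

theorem FirstFail.mono {S S' : Subst L} (hS : S.Le S') {P : List ℕ} {k : ℕ} {φ : SFm L (k + 1)}
    {s : Fin k → CTm L} {n : ℕ} (h : FirstFail S P φ s n) : FirstFail S' P φ s n := by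
  obtain ⟨P₁, P₂, rfl, h₁, h₂⟩ := h
  exact ⟨P₁, P₂, rfl, fun m hm => hS.sat (h₁ m hm), hS.sat h₂⟩

theorem FirstFail.unique {S : Subst L} {P : List ℕ} {k : ℕ} {φ : SFm L (k + 1)}
    {s : Fin k → CTm L} {n n' : ℕ} (h : FirstFail S P φ s n) (h' : FirstFail S P φ s n') :
    n = n' := by
  obtain ⟨P₁, P₂, rfl, h₁, h₂⟩ := h
  obtain ⟨P₁', P₂', hP, h₁', h₂'⟩ := h'
  induction P₁ generalizing P₁' with
  | nil =>
    cases P₁' with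
    | nil => simp at hP; exact hP.1
    | cons m P₁' =>
      simp only [List.nil_append, List.cons_append, List.cons.injEq] at hP
      obtain ⟨rfl, -⟩ := hP
      exact absurd (h₁' n (by simp)) (Subst.not_sat_of_sat_not h₂)
  | cons m P₁ ih =>
    cases P₁' with
    | nil =>
      simp only [List.nil_append, List.cons_append, List.cons.injEq] at hP
      obtain ⟨rfl, -⟩ := hP
      exact absurd (h₁ m (by simp)) (Subst.not_sat_of_sat_not h₂')
    | cons m' P₁' =>
      simp only [List.cons_append, List.cons.injEq] at hP
      exact ih (fun m hm => h₁ m (by simp [hm])) P₁' hP.2 fun m hm => h₁' m (by simp [hm])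

theorem HPair.mono {S S' : Subst L} (hS : S.Le S') {P : List ℕ} {cr : Crit L} {e : CExpr L}
    {v : Val} (h : HPair O S P cr e v) : HPair O S' P cr e v := by
  cases h with
  | pred s n v hs hv => exact .pred s n v (hS.evalTm hs) hv
  | eps φ s t a v hs ht => exact .eps φ s t a v (fun i => hS.evalTm (hs i)) (hS.evalTm ht)
  | ind φ s t a n v hs ht hvn h h' least =>
    exact .ind φ s t a n v (fun i => hS.evalTm (hs i)) (hS.evalTm ht) hvn (hS.sat h) (hS.sat h')
      fun m hm => hS.sat (least m hm)
  | indDef t n ht => exact .indDef t n (hS.evalTm ht)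
  | closureNeg φ s a n v hs hn hA hv =>
    exact .closureNeg φ s a n v (fun i => hS.evalTm (hs i)) (hn.mono hS) (hS.sat hA) (hS _ _ hv)
  | closurePos φ s a v hs hn hA =>
    exact .closurePos φ s a v (fun i => hS.evalTm (hs i)) (hn.mono hS) (hS.sat hA)

theorem eval_unique {S : Subst L} {k : ℕ} {s : Fin k → CTm L} {a a' : Fin k → ℕ}
    (h : ∀ i, (s i).eval S = some (a i)) (h' : ∀ i, (s i).eval S = some (a' i)) : a = a' :=
  funext fun i => Option.some_inj.1 ((h i).symm.trans (h' i))

/-- Together with monotonicity this shows that an extension produces no pair different from the one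
already computed, so the choice of the least rank and index is stable. -/
theorem HPair.unique {S : Subst L} {P : List ℕ} {cr : Crit L} {e e' : CExpr L}
    {v v' : Val} (h : HPair O S P cr e v) (h' : HPair O S P cr e' v') : e = e' ∧ v = v' := by
  cases h with
  | pred s n v hs hv =>
    cases h' with
    | pred _ n' v' hs' hv' =>
      obtain rfl : n = n' := Option.some_inj.1 (hs.symm.trans hs')
      obtain rfl : v = v' := PNat.coe_injective (hv.trans hv'.symm)
      exact ⟨rfl, rfl⟩
  | eps φ s t a v hs ht =>
    cases h' with
    | eps _ _ _ a' v' hs' ht' =>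
      obtain rfl := eval_unique hs hs'
      obtain rfl : v = v' := PNat.coe_injective (Option.some_inj.1 (ht.symm.trans ht'))
      exact ⟨rfl, rfl⟩
  | ind φ s t a n v hs ht hvn h h2 least =>
    cases h' with
    | ind _ _ _ a' n' v' hs' ht' hvn' h' h2' least' =>
      obtain rfl := eval_unique hs hs'
      have key : ∀ v : ℕ, S.Sat (φ.inst (Fin.cons (.num v) s)) →
          S.Sat (.not (φ.inst (Fin.cons (.num (v + 1)) s))) →
          ¬ S.Sat (.not (.and (φ.inst (Fin.cons (.num v) s))
            (.not (φ.inst (Fin.cons (.num (v + 1)) s))))) := fun v h₁ h₂ h₃ => by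
        rw [Subst.sat_not_iff] at h₂ h₃
        rw [Subst.Sat] at h₁
        simp [CFm.eval, h₁, h₂] at h₃
      obtain rfl : v = v' := PNat.coe_injective <| le_antisymm
        (not_lt.1 fun hlt => key _ h' h2' (least _ hlt))
        (not_lt.1 fun hlt => key _ h h2 (least' _ hlt))
      exact ⟨rfl, rfl⟩
  | indDef t n ht =>
    cases h' with
    | indDef _ n' ht' =>
      obtain rfl : n = n' := Option.some_inj.1 (ht.symm.trans ht')
      exact ⟨rfl, rfl⟩
  | closureNeg φ s a n v hs hn hA hv =>
    cases h' with
    | closureNeg _ _ a' n' v' hs' hn' hA' hv' =>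
      obtain rfl := eval_unique hs hs'
      obtain rfl := hn.unique hn'
      exact ⟨rfl, Option.some_inj.1 (hv.symm.trans hv')⟩
    | closurePos _ _ a' v' hs' hn' hA' =>
      obtain rfl := hn.unique hn'
      exact absurd hA' (Subst.not_sat_of_sat_not hA)
  | closurePos φ s a v hs hn hA =>
    cases h' with
    | closureNeg _ _ a' n' v' hs' hn' hA' hv' =>
      obtain rfl := hn.unique hn'
      exact absurd hA (Subst.not_sat_of_sat_not hA')
    | closurePos _ _ a' v' hs' hn' hA' =>
      obtain rfl := eval_unique hs hs'
      obtain rfl : v = v' := PNat.coe_injective (hn.unique hn')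
      exact ⟨rfl, rfl⟩

theorem HPair.ne_unk {S : Subst L} {P : List ℕ} {cr : Crit L} {e : CExpr L} {v : Val}
    (h : HPair O S P cr e v) : v ≠ .unk := by
  cases h <;> simp

theorem HPair.isNum {S : Subst L} {P : List ℕ} {cr : Crit L} {c : CanTerm L} {v : Val}
    (h : HPair O S P cr (.term c) v) : ∃ u, v = .num u := by
  generalize he : CExpr.term c = e at h
  cases h <;> simp_all

/-- Applicability of the `H`-step is inherited by extensions that are correct and compute
`F(e, u)` for their terms, if they leave the expressions of rank `Ω` and the main expression as
they are. -/
theorem HApplies.mono {N : ℕ} {Cr : Fin (N + 1) → Crit L} {S S' : Subst L} {P : List ℕ}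
    {e : CExpr L} {v : Val} (h : HApplies O Cr S P e v) (hS : S.Le S') (hc : S'.Correct O)
    (hcomp : S'.Computing O) (hΩ : ∀ e, e.rk O = Ω → S' e = S e) (hcn : ∀ n, (O.c n).rk O = Ω) :
    HApplies O Cr S' P e v where
  correct := hc
  -- Since `S` decides every critical formula, one that is false in `S'` was already false in `S`.
  nonsolving := fun hs => h.nonsolving fun i => by
    refine (h.decides i).elim (fun h => S.le_ext.sat h) fun hn => ?_
    exact absurd (hs i) (Subst.not_sat_of_sat_not (S'.le_ext.sat (hS.sat hn)))
  computing := hcomp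
  decides := fun i => hS.decides (h.decides i)
  pairs := fun i hi => by
    obtain ⟨e', v', h'⟩ := h.pairs i ((h.decides i).resolve_left fun hs =>
      Subst.not_sat_of_sat_not hi (hS.sat hs))
    exact ⟨e', v', h'.mono hS⟩
  main := by
    obtain ⟨i, hi, hp, hmin⟩ := h.main
    refine ⟨i, hS.sat hi, hp.mono hS, fun j e' v' hj hp' => ?_⟩
    have hj' := (h.decides j).resolve_left fun hs => Subst.not_sat_of_sat_not hj (hS.sat hs)
    obtain ⟨e'', v'', hp''⟩ := h.pairs j hj'
    obtain ⟨rfl, rfl⟩ := hp'.unique (hp''.mono hS)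
    exact hmin j _ _ hj' hp''
  unk := hS _ _ h.unk
  term := fun n hn => by rw [hΩ _ rfl]; exact h.term n hn
  form := fun n hn => by rw [hΩ _ (hcn n)]; exact h.form n hn
  conflict := fun n m hn hm => by
    rw [hΩ _ rfl]
    rw [hΩ _ (hcn m)] at hm
    exact h.conflict n m hn hm

end Pairs

-- Finite ranks, and the ranks consulted by `F(e, u)`

section Ranks

variable {L : FirstOrder.Language.{0, 0}} (O : OpForm L)

theorem inl_lt_Ω (n : ℕ) : (Sum.inlₗ n : Rank) < Ω := Sum.Lex.inl_lt_inr n 0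

theorem inl_le_inl {m n : ℕ} : (Sum.inlₗ m : Rank) ≤ Sum.inlₗ n ↔ m ≤ n :=
  Sum.Lex.inl_le_inl_iff

theorem inl_lt_inl {m n : ℕ} : (Sum.inlₗ m : Rank) < Sum.inlₗ n ↔ m < n :=
  Sum.Lex.inl_lt_inl_iff

theorem exists_eq_inl_of_lt_Ω {q : Rank} (h : q < Ω) : ∃ n, q = Sum.inlₗ n := by
  rcases q with n | n
  · exact ⟨n, rfl⟩
  · exact absurd (Sum.Lex.inr_lt_inr_iff.1 h) (Nat.not_lt_zero n)

theorem lt_inl_succ {q : Rank} {n : ℕ} : q < Sum.inlₗ (n + 1) ↔ q ≤ Sum.inlₗ n := by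
  constructor
  · intro h
    obtain ⟨m, rfl⟩ := exists_eq_inl_of_lt_Ω (h.trans (inl_lt_Ω _))
    exact inl_le_inl.2 (Nat.lt_succ_iff.1 (inl_lt_inl.1 h))
  · exact fun h => h.trans_lt (inl_lt_inl.2 n.lt_succ_self)

theorem inl_succ_le {q : Rank} {n : ℕ} : Sum.inlₗ (n + 1) ≤ q ↔ Sum.inlₗ n < q := by
  rw [← not_lt, lt_inl_succ, not_le]

theorem rk_c (n : ℕ) : (O.c n).rk O = Ω := by
  unfold OpForm.c CExpr.rk
  exact if_pos ⟨n, rfl⟩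

variable {O}

/-- The terms `c_n` are no exception here, because `I` occurs in `B`. -/
theorem rk_term_of_not_hasI {c : CanTerm L} (h : ¬ c.body.HasI) :
    (CExpr.term c).rk O = Sum.inlₗ (c.body.rkS + 1) := by
  unfold CExpr.rk
  dsimp only
  rw [if_neg, if_neg h]
  rintro ⟨n, rfl⟩
  exact h O.occurs

theorem rk_term_eq_inl {c : CanTerm L} {n : ℕ} (h : (CExpr.term c).rk O = Sum.inlₗ n) :
    ¬ c.body.HasI ∧ c.body.rkS + 1 = n := by
  by_cases hI : c.body.HasI
  · unfold CExpr.rk at h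
    simp only [hI, if_true] at h
    split_ifs at h
    · exact absurd h (inl_lt_Ω n).ne'
    · exact absurd h (Sum.Lex.inl_lt_inr _ _).ne'
  · rw [rk_term_of_not_hasI hI] at h
    exact ⟨hI, Sum.inl_injective h⟩

theorem exists_term_of_rk_le {e : CExpr L} {n : ℕ} (h : e.rk O ≤ Sum.inlₗ n) :
    ∃ c, e = .term c := by
  cases e with
  | term c => exact ⟨c, rfl⟩
  | form m => exact absurd h (inl_lt_Ω n).not_ge

/-- A formula that justifies the value of a term of rank at most `n` is evaluated with the values
of terms of smaller rank only. -/
theorem sat_FFm_congr [L.Structure ℕ] {S S' : Subst L} {e : CExpr L} {n : ℕ} {u : Val}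
    (he : e.rk O ≤ Sum.inlₗ n)
    (h : ∀ e', e'.rk O < Sum.inlₗ n → ∀ u, S e' = some u → S' e' = some u)
    (hs : S.Sat (FFm O e u)) : S'.Sat (FFm O e u) := by
  obtain ⟨c, rfl⟩ := exists_term_of_rk_le he
  obtain ⟨m, hm⟩ := exists_eq_inl_of_lt_Ω (he.trans_lt (inl_lt_Ω n))
  obtain ⟨hI, rfl⟩ := rk_term_eq_inl hm
  rw [hm] at he
  refine CFm.eval_mono (fun k φ a u hφ hu => h _ ?_ u hu) (fun h => h.elim) _
    (FFm_term_all O c u hI) hs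
  rw [rk_term_of_not_hasI hφ.2]
  exact (inl_lt_inl.2 (Nat.lt_succ_of_le hφ.1)).trans_le he

theorem sat_FFm_unk [L.Structure ℕ] (S : Subst L) (e : CExpr L) : S.Sat (FFm O e .unk) := by
  cases e <;> exact S.sat_top

end Ranks

-- Derivability as a proposition, and paths as an inductive predicate

section Derivability

variable {L : FirstOrder.Language.{0, 0}} [L.Structure ℕ] (O : OpForm L) {N : ℕ}
  (Cr : Fin (N + 1) → Crit L)

/-- The rules admitted in an `r`-derivation. -/
def DerRule (r : Rank) : Kind → Rank → Prop
  | .cut, q => q < r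
  | .cutFr, _ => False
  | .fr, q => r ≤ q
  | .h, q => r ≤ q

/-- There is an `r`-derivation. -/
inductive RDer (r : Rank) : Sequent L → Prop
  | ax {Θ : Sequent L} (h : IsAxiom O Cr Θ) : RDer r Θ
  | inf {X : Kind} {e : CExpr L} {Θ : Sequent L} {Pr : Set (Sequent L)}
      (h : Inference O Cr X e Θ Pr) (hX : DerRule r X (e.rk O)) (d : ∀ Θ' ∈ Pr, RDer r Θ') :
      RDer r Θ

variable {O Cr}

theorem RDer.of_derivation {r : Rank} {Θ : Sequent L} (d : Derivation O Cr Θ)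
    (h : d.IsRDeduction r) : RDer O Cr r Θ := by
  induction d with
  | hyp Θ hΘ => exact hΘ.elim
  | ax Θ hΘ => exact .ax hΘ
  | inf X e Θ Pr hi d ih =>
    refine .inf hi ?_ fun Θ' hΘ' => ih Θ' hΘ'
      ⟨h.cut.2 _ hΘ', h.cutFr.2 _ hΘ', h.fr.2 _ hΘ', h.h.2 _ hΘ'⟩
    cases X with
    | cut => exact h.cut.1 rfl
    | cutFr =>
      have := h.cutFr.1 rfl
      obtain ⟨m, hm⟩ := exists_eq_inl_of_lt_Ω (this.trans (inl_lt_Ω 0))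
      rw [hm, inl_lt_inl] at this
      exact Nat.not_lt_zero _ this
    | fr => exact h.fr.1 rfl
    | h => exact h.h.1 rfl

theorem RDer.exists_derivation {r : Rank} {Θ : Sequent L} (h : RDer O Cr r Θ) :
    ∃ d : Derivation O Cr Θ, d.IsRDeduction r := by
  induction h with
  | ax h => exact ⟨.ax _ h, trivial, trivial, trivial, trivial⟩
  | @inf X e Θ Pr hi hX _ ih =>
    choose d hd using ih
    refine ⟨.inf X e Θ Pr hi d, ⟨?_, fun Θ' h => (hd Θ' h).cut⟩, ⟨?_, fun Θ' h => (hd Θ' h).cutFr⟩,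
      ⟨?_, fun Θ' h => (hd Θ' h).fr⟩, ⟨?_, fun Θ' h => (hd Θ' h).h⟩⟩ <;> rintro rfl
    · exact hX
    · exact hX.elim
    · exact hX
    · exact hX

variable (O Cr)

/-- `Θ` is reached from the empty sequent by rules whose kind and rank satisfy `p`. -/
inductive Path (p : Kind → Rank → Prop) : Sequent L → Prop
  | nil : Path p Sequent.empty
  | step {X : Kind} {e : CExpr L} {Θ Θ' : Sequent L} {Pr : Set (Sequent L)} (hΘ : Path p Θ)
      (h : Inference O Cr X e Θ Pr) (hX : p X (e.rk O)) (hΘ' : Θ' ∈ Pr) : Path p Θ'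

variable {O Cr}

theorem Path.mono {p p' : Kind → Rank → Prop} (h : ∀ X q, p X q → p' X q) {Θ : Sequent L}
    (hΘ : Path O Cr p Θ) : Path O Cr p' Θ := by
  induction hΘ with
  | nil => exact .nil
  | step _ hi hX hΘ' ih => exact ih.step hi (h _ _ hX) hΘ'

/-- `Cut` rules of rank `≤ r`, and `Fr` and `H` rules with ranks that satisfy `p`. -/
def PathRule (r : Rank) (p : Rank → Prop) : Kind → Rank → Prop
  | .cut, q => q ≤ r
  | .cutFr, _ => False
  | .fr, q => p q
  | .h, q => p q

theorem HasPath.path {r : Rank} {Θ : Sequent L} (h : HasPath O Cr r Θ) :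
    Path O Cr (PathRule r (Ω ≤ ·)) Θ := by
  obtain ⟨n, Θs, h0, rfl, hs⟩ := h
  induction n with
  | zero => rw [h0]; exact .nil
  | succ n ih =>
    obtain ⟨X, e, Pr, hi, hΘ', hX⟩ := hs n n.lt_succ_self
    refine (ih fun i hi => hs i (hi.trans n.lt_succ_self)).step hi ?_ hΘ'
    cases X <;> exact hX

end Derivability

-- Replacing the part of low rank of a sequent

section Combination

variable {L : FirstOrder.Language.{0, 0}} {O : OpForm L}

theorem Subst.filter_congr {S S' : Subst L} {p : CExpr L → Val → Prop} {e : CExpr L}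
    (h : S e = S' e ∨ ∀ u, ¬ p e u) : S.filter p e = S'.filter p e := by
  unfold Subst.filter
  rcases h with h | h
  · rw [h]
  · cases S e <;> cases S' e <;> simp [h]

theorem Subst.filter_of_forall {S : Subst L} {p : CExpr L → Val → Prop} {e : CExpr L}
    (h : ∀ u, p e u) : S.filter p e = S e := by
  unfold Subst.filter
  cases hS : S e <;> simp [h]

theorem Subst.filter_of_not {S : Subst L} {p : CExpr L → Val → Prop} {e : CExpr L}
    (h : ∀ u, ¬ p e u) : S.filter p e = none := by
  unfold Subst.filter
  cases hS : S e <;> simp [h]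

variable (O)

open Classical in
/-- The sequent that agrees with `X` on the expressions of rank at most `n`, and with `Ψ`
otherwise. -/
noncomputable def Sequent.comb (n : ℕ) (Ψ X : Sequent L) : Sequent L where
  S := fun e => if e.rk O ≤ Sum.inlₗ n then X.S e else Ψ.S e
  P := Ψ.P
  V := Ψ.V
  F := fun e => if e.rk O ≤ Sum.inlₗ n then X.F e else Ψ.F e

/-- All records of the history consist of expressions of rank `Ω`. -/
def Sequent.RecordsΩ (Ψ : Sequent L) : Prop :=
  ∀ m T e, Ψ.V m = some T → e.rk O ≠ Ω → T e = none

variable {O} {n : ℕ} {Ψ X : Sequent L} {e : CExpr L}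

theorem comb_S_low (h : e.rk O ≤ Sum.inlₗ n) : (Ψ.comb O n X).S e = X.S e := if_pos h

theorem comb_S_high (h : Sum.inlₗ n < e.rk O) : (Ψ.comb O n X).S e = Ψ.S e := if_neg h.not_ge

theorem comb_F_low (h : e.rk O ≤ Sum.inlₗ n) : (Ψ.comb O n X).F e = X.F e := if_pos h

theorem comb_F_high (h : Sum.inlₗ n < e.rk O) : (Ψ.comb O n X).F e = Ψ.F e := if_neg h.not_ge

theorem comb_S_Ω (h : e.rk O = Ω) : (Ψ.comb O n X).S e = Ψ.S e :=
  comb_S_high (h ▸ inl_lt_Ω n)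

theorem comb_negΩ : (Ψ.comb O n X).S.negΩ O = Ψ.S.negΩ O := by
  funext e
  by_cases h : e.rk O = Ω
  · exact Subst.filter_congr (Or.inl (comb_S_Ω h))
  · exact Subst.filter_congr (Or.inr fun u hu => h hu.1)

theorem negΩ_of_rk_ne (S : Subst L) (h : e.rk O ≠ Ω) : S.negΩ O e = none :=
  Subst.filter_of_not fun _ hu => h hu.1

theorem posΩ_of_rk_ne (S : Subst L) (h : e.rk O ≠ Ω) : S.posΩ O e = none :=
  Subst.filter_of_not fun _ hu => h hu.1

theorem Sequent.RecordsΩ.comb (h : Ψ.RecordsΩ O) : (Ψ.comb O n X).RecordsΩ O := h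

theorem hData_of_lt_Ω {v : Val} (h : e.rk O < Ω) :
    hData O e v Ψ =
      ((Ψ.S.filter fun e' _ => e'.rk O ≤ e.rk O).set e v, [], fun _ => none) := by
  unfold hData
  rw [if_neg h.not_gt, if_pos h]

theorem hData_of_Ω_lt {v : Val} (h : Ω < e.rk O) :
    hData O e v Ψ =
      ((Ψ.S.filter fun e' _ => e'.rk O ≤ e.rk O).set e v, Ψ.P, Ψ.V) := by
  unfold hData
  rw [if_pos h]

/-- An `H`-step of rank other than `Ω` retains everything up to its own rank. At rank `Ω` all
smaller ranks are retained, and what is put back, including a record restored from the history, has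
rank `Ω` only. -/
theorem hData_S_low {v : Val} {e' : CExpr L} (hV : Ψ.RecordsΩ O) (he : Sum.inlₗ n < e.rk O)
    (he' : e'.rk O ≤ Sum.inlₗ n) : (hData O e v Ψ).1 e' = Ψ.S e' := by
  have hne : e' ≠ e := by
    rintro rfl
    exact he.not_ge he'
  have hlt : e'.rk O < Ω := he'.trans_lt (inl_lt_Ω n)
  rcases lt_trichotomy (e.rk O) Ω with h | h | h
  · rw [hData_of_lt_Ω h]
    refine (Subst.set_of_ne hne _ _).trans ?_
    exact Subst.filter_of_forall fun _ => he'.trans he.le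
  · unfold hData
    rw [if_neg h.not_gt, if_neg h.not_lt]
    have h1 : (Ψ.S.filter fun e' _ => e'.rk O < Ω) e' = Ψ.S e' :=
      Subst.filter_of_forall fun _ => hlt
    cases e with
    | form m =>
      simp only [Subst.set_of_ne hne, Subst.union, h1, posΩ_of_rk_ne _ hlt.ne, Option.or_none]
    | term c =>
      simp only [Subst.set_of_ne hne, Subst.union, h1]
      have h2 : ∀ (p : ℕ → Prop), (Ψ.S.filter fun e' u => ∃ m, p m ∧
          (e' = O.c m ∧ u = .unk ∨ e' = .form m ∧ u = .top)) e' = none := fun p =>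
        Subst.filter_of_not fun u => by
          rintro ⟨m, -, ⟨rfl, -⟩ | ⟨rfl, -⟩⟩
          · exact hlt.ne (rk_c O m)
          · exact hlt.ne rfl
      rw [h2, Option.none_or]
      split_ifs with hn hn' hn'
      -- Two of the four cases use the default index `0`, meant for terms not of the form `c_n`. A
      -- missing record counts as the empty substitution, so all four cases end alike.
      · cases hT : Ψ.V hn.choose with
        | none => simp
        | some T => simp [hV _ T e' hT hlt.ne]
      · rw [negΩ_of_rk_ne _ hlt.ne, Option.or_none]
      · cases hT : Ψ.V 0 with
        | none => simp
        | some T => simp [hV _ T e' hT hlt.ne]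
      · rw [negΩ_of_rk_ne _ hlt.ne, Option.or_none]
  · rw [hData_of_Ω_lt h]
    refine (Subst.set_of_ne hne _ _).trans ?_
    exact Subst.filter_of_forall fun _ => he'.trans he.le

theorem hData_comb_S_high {v : Val} {e' : CExpr L} (he' : Sum.inlₗ n < e'.rk O) :
    (hData O e v (Ψ.comb O n X)).1 e' = (hData O e v Ψ).1 e' := by
  by_cases hne : e' = e
  · subst hne
    unfold hData
    split_ifs
    · simp only [Subst.set_self]
    · simp only [Subst.set_self]
    · cases e' <;> simp only [Subst.set_self]
  · have hf : ∀ p, (Ψ.comb O n X).S.filter p e' = Ψ.S.filter p e' := fun p =>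
      Subst.filter_congr (Or.inl (comb_S_high he'))
    unfold hData
    split_ifs
    · simp only [Subst.set_of_ne hne, hf]
    · simp only [Subst.set_of_ne hne, hf]
    · cases e with
      | form m => simp only [Subst.set_of_ne hne, Subst.union, Subst.posΩ, hf]
      | term c =>
        simp only [Subst.set_of_ne hne, Subst.union, comb_negΩ, hf]
        rfl

theorem hData_comb_history {v : Val} :
    (hData O e v (Ψ.comb O n X)).2 = (hData O e v Ψ).2 := by
  unfold hData
  split_ifs
  · rfl
  · rfl
  · cases e with
    | form m => simp only [comb_negΩ]; rfl
    | term c => rfl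

variable (O n)

/-- `X` collects expressions of rank at most `n`, those with value `?` being labelled; only those
of rank `n` may be temporary. -/
structure Low (X : Sequent L) : Prop where
  P : X.P = []
  V : X.V = fun _ => none
  rank : ∀ e u, X.S e = some u → e.rk O ≤ Sum.inlₗ n
  ne_top : ∀ e, X.S e ≠ some .top
  domF : ∀ e, (X.F e).isSome ↔ X.S e = some .unk
  temp : ∀ e, X.F e = some true → e.rk O = Sum.inlₗ n

variable {O n}

theorem Low.comb_empty (hX : Low O n X) : Sequent.empty.comb O n X = X := by
  refine Sequent.ext (funext fun e => ?_) hX.P.symm hX.V.symm (funext fun e => ?_)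
  · by_cases h : e.rk O ≤ Sum.inlₗ n
    · exact comb_S_low h
    · rw [comb_S_high (not_le.1 h)]
      cases hu : X.S e with
      | none => rfl
      | some u => exact absurd (hX.rank e u hu) h
  · by_cases h : e.rk O ≤ Sum.inlₗ n
    · exact comb_F_low h
    · rw [comb_F_high (not_le.1 h)]
      cases hi : X.F e with
      | none => rfl
      | some i => exact absurd (hX.rank e _ ((hX.domF e).1 (by simp [hi]))) h

/-- `H`-steps of rank above `n` commute with the replacement: they preserve the low part, and their
effect on the high part and the history does not depend on it. -/
theorem hSeq_comb {v : Val} (hX : Low O n X) (hV : Ψ.RecordsΩ O) (he : Sum.inlₗ n < e.rk O) :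
    hSeq O e v (Ψ.comb O n X) = (hSeq O e v Ψ).comb O n X := by
  have hS : ∀ e', (hData O e v (Ψ.comb O n X)).1 e' = ((hSeq O e v Ψ).comb O n X).S e' := by
    intro e'
    by_cases h : e'.rk O ≤ Sum.inlₗ n
    · rw [hData_S_low hV.comb he h, comb_S_low h, comb_S_low h]
    · rw [hData_comb_S_high (not_le.1 h), comb_S_high (not_le.1 h)]
      rfl
  refine Sequent.ext (funext hS) (congrArg Prod.fst hData_comb_history)
    (congrArg Prod.snd hData_comb_history) (funext fun e' => ?_)
  by_cases h : e'.rk O ≤ Sum.inlₗ n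
  · rw [comb_F_low h]
    simp only [hSeq, hS, comb_S_low h, comb_F_low h]
    -- The default label of new expressions never appears at low rank, since `X` labels exactly its
    -- expressions with value `?`.
    have hne : e'.rk O ≠ Ω := (h.trans_lt (inl_lt_Ω n)).ne
    have hd := hX.domF e'
    cases hu : X.S e' with
    | none =>
      cases hi : X.F e' with
      | none => rfl
      | some i => simp [hu, hi] at hd
    | some u =>
      cases hi : X.F e' with
      | none =>
        rw [hu, hi] at hd
        have : u ≠ .unk := fun h => by simp [h] at hd
        simp [this, hne]
      | some i =>
        rw [hu, hi] at hd
        simp at hd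
        simp [hd]
  · rw [comb_F_high (not_le.1 h)]
    simp only [hSeq, hS, comb_S_high (not_le.1 h), comb_F_high (not_le.1 h)]

theorem active_comb {v : Val} {e' : CExpr L} (hX : Low O n X) (hV : Ψ.RecordsΩ O)
    (he : Sum.inlₗ n < e.rk O) : Active O e v (Ψ.comb O n X) e' ↔ Active O e v Ψ e' := by
  unfold Active
  rw [hSeq_comb hX hV he]
  by_cases h : e'.rk O = e.rk O
  · have h' : Sum.inlₗ n < e'.rk O := h ▸ he
    simp only [Subst.dom, Set.mem_ofPred_eq, comb_S_high h']
  · simp [h]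

/-- At finite rank the `H`-step changes no value of its own rank except that of the `H`-expression.
Hence this one label decides between `AxH` and the `H` rule. -/
theorem Active.eq_of_lt_Ω {v : Val} {e' : CExpr L} (h : Active O e v Ψ e') (he : e.rk O < Ω) :
    e' = e := by
  by_contra hne
  refine h.2.2 ?_
  change (hData O e v Ψ).1 e' = Ψ.S e'
  rw [hData_of_lt_Ω he]
  refine (Subst.set_of_ne hne _ _).trans ?_
  exact Subst.filter_of_forall fun _ => h.2.1.le

theorem active_self {v : Val} (he : e.rk O < Ω) (h : Ψ.S e = some .unk) (hv : v ≠ .unk) :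
    Active O e v Ψ e := by
  refine ⟨by simp [Subst.dom, h], rfl, ?_⟩
  change (hData O e v Ψ).1 e ≠ Ψ.S e
  rw [hData_of_lt_Ω he, h]
  exact fun h' => hv (Option.some_inj.1 ((Subst.set_self _ _ _).symm.trans h'))

theorem le_comb (h : ∀ e u, e.rk O ≤ Sum.inlₗ n → Ψ.S e = some u → X.S e = some u) :
    Ψ.S.Le (Ψ.comb O n X).S := fun e u hu => by
  by_cases he : e.rk O ≤ Sum.inlₗ n
  · rw [comb_S_low he]
    exact h e u he hu
  · rw [comb_S_high (not_le.1 he)]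
    exact hu

theorem Low.le_comb (hX : Low O n X) : X.S.Le (Ψ.comb O n X).S := fun e u hu => by
  rw [comb_S_low (hX.rank e u hu)]
  exact hu

variable [L.Structure ℕ] {N : ℕ} {Cr : Fin (N + 1) → Crit L}

/-- `X` extends the part of `Ψ` of rank at most `n`, and it satisfies the formulas that justify the
values of the additional expressions. -/
structure Fits (O : OpForm L) (n : ℕ) (Ψ X : Sequent L) : Prop where
  le : ∀ e u, e.rk O ≤ Sum.inlₗ n → Ψ.S e = some u → X.S e = some u
  just : ∀ e u, X.S e = some u → e ∈ Ψ.S.dom ∨ X.S.Sat (FFm O e u)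

/-- A value inherited from `Ψ` is justified by a computation inside `Ψ`, and an additional value by
one inside `X`; the combination extends both substitutions. -/
theorem Fits.sat_comb {c : CanTerm L} {u : Val} (h : Fits O n Ψ X) (hX : Low O n X)
    (hc : Ψ.S.Correct O) (hc' : Ψ.S.Computing O) (hu : (Ψ.comb O n X).S (.term c) = some u) :
    (Ψ.comb O n X).S.Sat (FFm O (.term c) u) := by
  by_cases he : (CExpr.term c).rk O ≤ Sum.inlₗ n
  · rw [comb_S_low he] at hu
    refine (h.just _ _ hu).elim (fun hd => ?_) hX.le_comb.sat
    obtain ⟨u', hu'⟩ := Option.isSome_iff_exists.1 hd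
    obtain rfl : u = u' := Option.some_inj.1 (hu.symm.trans (h.le _ _ he hu'))
    exact (EpsID.le_comb h.le).sat (Subst.sat_FFm hc hc' hu')
  · rw [comb_S_high (not_le.1 he)] at hu
    exact (EpsID.le_comb h.le).sat (Subst.sat_FFm hc hc' hu)

theorem Fits.happlies {e : CExpr L} {v : Val} (h : Fits O n Ψ X) (hX : Low O n X)
    (ha : HApplies O Cr Ψ.S Ψ.P e v) :
    HApplies O Cr (Ψ.comb O n X).S (Ψ.comb O n X).P e v := by
  have hsat := fun c u => h.sat_comb (c := c) (u := u) hX ha.correct ha.computing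
  refine ha.mono (EpsID.le_comb h.le) ?_ (fun c u hu => Or.inl (hsat c u hu))
    (fun e he => comb_S_Ω he) (rk_c O)
  intro e' u hu
  cases e' with
  | term c => exact Subst.le_ext _ |>.sat (hsat c u hu)
  | form m =>
    cases u with
    | unk => exact Subst.sat_top _
    | num u => exact Subst.sat_top _
    | top =>
      rw [comb_S_Ω rfl] at hu
      -- `A(m, I)` is only known to hold in the standard extension, so extending `Ψ` is not enough.
      -- But its evaluation consults only expressions of rank `Ω`, where the combination agrees with
      -- `Ψ`.
      refine CFm.eval_mono (fun k φ a u hφ => ?_) (fun _ m u => ?_) _ (A_inst_all O m)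
        (ha.correct _ _ hu)
      · obtain ⟨i, hi⟩ := hφ a
        rw [hi, Subst.ext, Subst.ext, comb_S_Ω (e := .term (O.cTerm i)) (rk_c O i)]
        exact id
      · rw [Subst.ext, Subst.ext, comb_S_Ω rfl]
        exact id

theorem Subst.Inconsistent.mono {S S' : Subst L} (hS : S.Le S') (h : S.Inconsistent O) :
    S'.Inconsistent O :=
  h.imp (fun ⟨e, u, hu, hs⟩ => ⟨e, u, hS _ _ hu, hS.sat hs⟩)
    fun ⟨m, u, h, h'⟩ => ⟨m, u, hS _ _ h, hS _ _ h'⟩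

/-- The critical formulas are true in `S` itself, by decidedness, and this persists although the
default values in the standard extension may be overwritten. -/
theorem isAxiom_of_solving {S : Subst L} (hS : S.Le X.S) (h : S.Solving O Cr)
    (h' : ∀ i, S.Decides ((Cr i).fm O)) : IsAxiom O Cr X := by
  have hs : ∀ i, X.S.Sat ((Cr i).fm O) := fun i => by
    refine (h' i).elim (fun h => hS.sat h) fun hn => ?_
    exact absurd (h i) (Subst.not_sat_of_sat_not (S.le_ext.sat hn))
  exact .axS (fun i => X.S.le_ext.sat (hs i)) fun i => Or.inl (hs i)

end Combination

-- Replaying the rules of a path over another low part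

section Steps

variable {L : FirstOrder.Language.{0, 0}} {O : OpForm L} {n : ℕ} {Ψ Ψ' X : Sequent L}
  {e : CExpr L}

theorem comb_addUnk_high (he : Sum.inlₗ n < e.rk O) (i : Bool) :
    (Ψ.addUnk e i).comb O n X = (Ψ.comb O n X).addUnk e i := by
  refine Sequent.ext (funext fun e' => ?_) rfl rfl (funext fun e' => ?_) <;>
  by_cases hne : e' = e
  · subst hne
    simp [Sequent.addUnk, Sequent.comb, he.not_ge, Subst.set_self]
  · simp [Sequent.addUnk, Sequent.comb, Subst.set_of_ne hne]
  · subst hne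
    simp [Sequent.addUnk, Sequent.comb, he.not_ge]
  · simp [Sequent.addUnk, Sequent.comb, hne]

/-- The combination ignores the low part of its first argument. A `Cut` of low rank in `Ψ` can
therefore be followed to a premise without any inference. -/
theorem comb_addUnk_of_low (he : e.rk O ≤ Sum.inlₗ n) (i : Bool) :
    (Ψ.addUnk e i).comb O n X = Ψ.comb O n X := by
  refine Sequent.ext (funext fun e' => ?_) rfl rfl (funext fun e' => ?_) <;>
  by_cases hne : e' = e
  · subst hne
    simp [Sequent.comb, he]
  · simp [Sequent.addUnk, Sequent.comb, Subst.set_of_ne hne]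
  · subst hne
    simp [Sequent.comb, he]
  · simp [Sequent.addUnk, Sequent.comb, hne]

theorem comb_addVal_of_low (he : e.rk O ≤ Sum.inlₗ n) (u : ℕ+) :
    (Ψ.addVal e u).comb O n X = Ψ.comb O n X := by
  refine Sequent.ext (funext fun e' => ?_) rfl rfl rfl
  by_cases hne : e' = e
  · subst hne
    simp [Sequent.comb, he]
  · simp [Sequent.addVal, Sequent.comb, Subst.set_of_ne hne]

theorem comb_addUnk_right (he : e.rk O ≤ Sum.inlₗ n) (i : Bool) :
    Ψ.comb O n (X.addUnk e i) = (Ψ.comb O n X).addUnk e i := by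
  refine Sequent.ext (funext fun e' => ?_) rfl rfl (funext fun e' => ?_) <;>
  by_cases hne : e' = e
  · subst hne
    simp [Sequent.addUnk, Sequent.comb, he, Subst.set_self]
  · simp [Sequent.addUnk, Sequent.comb, Subst.set_of_ne hne]
  · subst hne
    simp [Sequent.addUnk, Sequent.comb, he]
  · simp [Sequent.addUnk, Sequent.comb, hne]

theorem comb_addVal_right (he : e.rk O ≤ Sum.inlₗ n) (u : ℕ+) :
    Ψ.comb O n (X.addVal e u) = (Ψ.comb O n X).addVal e u := by
  refine Sequent.ext (funext fun e' => ?_) rfl rfl rfl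
  by_cases hne : e' = e
  · subst hne
    simp [Sequent.addVal, Sequent.comb, he, Subst.set_self]
  · simp [Sequent.addVal, Sequent.comb, Subst.set_of_ne hne]

theorem Low.addUnk (hX : Low O n X) (he : e.rk O ≤ Sum.inlₗ n) {i : Bool}
    (hi : i = true → e.rk O = Sum.inlₗ n) : Low O n (X.addUnk e i) where
  P := hX.P
  V := hX.V
  rank := fun e' u h => by
    by_cases hne : e' = e
    · rwa [hne]
    · exact hX.rank e' u ((Subst.set_of_ne hne _ _).symm.trans h)
  ne_top := fun e' => by
    by_cases hne : e' = e
    · subst hne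
      simp [Sequent.addUnk, Subst.set_self]
    · simpa [Sequent.addUnk, Subst.set_of_ne hne] using hX.ne_top e'
  domF := fun e' => by
    by_cases hne : e' = e
    · subst hne
      simp [Sequent.addUnk, Subst.set_self]
    · simpa [Sequent.addUnk, Subst.set_of_ne hne, hne] using hX.domF e'
  temp := fun e' => by
    by_cases hne : e' = e
    · subst hne
      simpa [Sequent.addUnk] using hi
    · simpa [Sequent.addUnk, hne] using hX.temp e'

theorem Low.F_eq_none (hX : Low O n X) (he : X.S e ≠ some .unk) : X.F e = none := by
  rw [← Option.not_isSome_iff_eq_none, hX.domF]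
  exact he

theorem Low.addVal (hX : Low O n X) (he : e.rk O ≤ Sum.inlₗ n) (hn : X.S e = none) (u : ℕ+) :
    Low O n (X.addVal e u) where
  P := hX.P
  V := hX.V
  rank := fun e' v h => by
    by_cases hne : e' = e
    · rwa [hne]
    · exact hX.rank e' v ((Subst.set_of_ne hne _ _).symm.trans h)
  ne_top := fun e' => by
    by_cases hne : e' = e
    · subst hne
      simp [Sequent.addVal, Subst.set_self]
    · simpa [Sequent.addVal, Subst.set_of_ne hne] using hX.ne_top e'
  domF := fun e' => by
    by_cases hne : e' = e
    · subst hne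
      simp [Sequent.addVal, Subst.set_self, hX.F_eq_none (e := e') (by simp [hn])]
    · simpa [Sequent.addVal, Subst.set_of_ne hne, hne] using hX.domF e'
  temp := hX.temp

theorem Sequent.RecordsΩ.hSeq {v : Val} (hV : Ψ.RecordsΩ O) : (hSeq O e v Ψ).RecordsΩ O := by
  intro m T e' hT he'
  rcases lt_trichotomy (e.rk O) Ω with h | h | h
  · simp [EpsID.hSeq, hData_of_lt_Ω h] at hT
  · simp only [EpsID.hSeq, hData, h, lt_irrefl, if_false] at hT
    cases e with
    | form k =>
      by_cases hk : m = k
      · subst hk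
        simp only [Function.update_self, Option.some_inj] at hT
        exact hT ▸ negΩ_of_rk_ne _ he'
      · simp only [Function.update_of_ne hk] at hT
        exact hV m T e' hT he'
    | term c =>
      simp only at hT
      split_ifs at hT
      all_goals exact hV m T e' hT he'
  · simp only [EpsID.hSeq, hData_of_Ω_lt h] at hT
    exact hV m T e' hT he'

variable [L.Structure ℕ] {N : ℕ} {Cr : Fin (N + 1) → Crit L}

/-- The rules that do not change the part of rank at most `n` of a sequent, except for new
expressions with fixed values. -/
abbrev HighRule (n : ℕ) : Kind → Rank → Prop := PathRule (Sum.inlₗ n) (Sum.inlₗ n < ·)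

theorem Inference.low_le {K : Kind} {Pr : Set (Sequent L)} (hi : Inference O Cr K e Ψ Pr)
    (hK : HighRule n K (e.rk O)) (hV : Ψ.RecordsΩ O) (hΨ' : Ψ' ∈ Pr) {e' : CExpr L} {u : Val}
    (he' : e'.rk O ≤ Sum.inlₗ n) (hu : Ψ.S e' = some u) : Ψ'.S e' = some u := by
  cases hi with
  | cut c Θ hr hc =>
    have hn : Ψ.S (.term c) = none := by simpa [Subst.dom] using hc
    rcases hΨ' with rfl | ⟨v, rfl⟩
    · exact Subst.le_set hn _ _ _ hu
    · exact Subst.le_set hn _ _ _ hu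
  | cutFr => exact hK.elim
  | cutTerm c Θ hr => exact absurd (hr ▸ hK) (inl_lt_Ω n).not_ge
  | cutFrTerm => exact hK.elim
  | cutForm m => exact absurd hK (inl_lt_Ω n).not_ge
  | fr e Θ he =>
    have hn : Ψ.S e = none := by simpa [Subst.dom] using he
    obtain rfl := hΨ'
    exact Subst.le_set hn _ _ _ hu
  | h e v Θ =>
    obtain rfl := hΨ'
    exact (hData_S_low hV hK he').trans hu

variable (O n) in
/-- Properties of the sequents reached from the empty one by rules of high rank. -/
structure Tame (Ψ : Sequent L) : Prop where
  records : Ψ.RecordsΩ O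
  ne_top : ∀ e, e.rk O ≤ Sum.inlₗ n → Ψ.S e ≠ some .top
  domF : ∀ e, e.rk O ≤ Sum.inlₗ n → ((Ψ.F e).isSome ↔ Ψ.S e = some .unk)
  fixed : ∀ e, e.rk O ≤ Sum.inlₗ n → Ψ.F e ≠ some true

theorem Inference.tame {K : Kind} {Pr : Set (Sequent L)} (hi : Inference O Cr K e Ψ Pr)
    (hK : HighRule n K (e.rk O)) (h : Tame O n Ψ) (hΨ' : Ψ' ∈ Pr) : Tame O n Ψ' := by
  cases hi with
  | cut c Θ hr hc =>
    have hn : Ψ.S (.term c) = none := by simpa [Subst.dom] using hc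
    rcases hΨ' with rfl | ⟨v, rfl⟩
    · refine ⟨h.records, fun e he => ?_, fun e he => ?_, fun e he => ?_⟩ <;>
      by_cases hne : e = .term c
      · simp [hne, Sequent.addUnk, Subst.set_self]
      · simpa [Sequent.addUnk, Subst.set_of_ne hne] using h.ne_top e he
      · simp [hne, Sequent.addUnk, Subst.set_self]
      · simpa [Sequent.addUnk, Subst.set_of_ne hne, hne] using h.domF e he
      · simp [hne, Sequent.addUnk]
      · simpa [Sequent.addUnk, hne] using h.fixed e he
    · refine ⟨h.records, fun e he => ?_, fun e he => ?_, h.fixed⟩ <;>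
      by_cases hne : e = .term c
      · simp [hne, Sequent.addVal, Subst.set_self]
      · simpa [Sequent.addVal, Subst.set_of_ne hne] using h.ne_top e he
      · subst hne
        have := h.domF _ he
        simp only [hn, reduceCtorEq, iff_false, Bool.not_eq_true, Option.isSome_eq_false_iff]
          at this
        simpa [Sequent.addVal, Subst.set_self] using this
      · simpa [Sequent.addVal, Subst.set_of_ne hne, hne] using h.domF e he
  | cutFr => exact hK.elim
  | cutTerm c Θ hr => exact absurd (hr ▸ hK) (inl_lt_Ω n).not_ge
  | cutFrTerm => exact hK.elim
  | cutForm m => exact absurd hK (inl_lt_Ω n).not_ge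
  | fr e Θ he =>
    obtain rfl := hΨ'
    have key : ∀ e', e'.rk O ≤ Sum.inlₗ n → e' ≠ e := by
      rintro e' he' rfl
      exact he'.not_gt hK
    refine ⟨h.records, fun e he => ?_, fun e he => ?_, fun e he => ?_⟩
    · simpa [Sequent.addUnk, Subst.set_of_ne (key e he)] using h.ne_top e he
    · simpa [Sequent.addUnk, Subst.set_of_ne (key e he), key e he] using h.domF e he
    · simpa [Sequent.addUnk, key e he] using h.fixed e he
  | h e v Θ =>
    obtain rfl := hΨ'
    have hS : ∀ e', e'.rk O ≤ Sum.inlₗ n → (hData O e v Ψ).1 e' = Ψ.S e' := fun e' he' =>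
      hData_S_low h.records hK he'
    have hF : ∀ e', e'.rk O ≤ Sum.inlₗ n → (hSeq O e v Ψ).F e' = Ψ.F e' := fun e' he' => by
      have hne : e'.rk O ≠ Ω := (he'.trans_lt (inl_lt_Ω n)).ne
      have hd := h.domF e' he'
      simp only [hSeq, hS e' he']
      cases hu : Ψ.S e' with
      | none =>
        cases hi : Ψ.F e' with
        | none => rfl
        | some i => simp [hu, hi] at hd
      | some u =>
        cases hi : Ψ.F e' with
        | none =>
          rw [hu, hi] at hd
          have : u ≠ .unk := fun h => by simp [h] at hd
          simp [this, hne]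
        | some i =>
          rw [hu, hi] at hd
          simp at hd
          simp [hd]
    refine ⟨h.records.hSeq, fun e he => ?_, fun e he => ?_, fun e he => ?_⟩
    · exact fun h' => h.ne_top e he ((hS e he).symm.trans h')
    · rw [hF e he]
      exact (h.domF e he).trans (by rw [← hS e he]; rfl)
    · rw [hF e he]
      exact h.fixed e he

/-- Along such a path low expressions arise only as main expressions of `Cut`, hence with fixed
labels; this starts the elimination without any temporary low expression. -/
theorem Path.tame (h : Path O Cr (HighRule n) Ψ) : Tame O n Ψ := by
  induction h with
  | nil => exact ⟨fun _ _ _ h => by simp [Sequent.empty] at h, fun _ _ => by simp [Sequent.empty],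
      fun _ _ => by simp [Sequent.empty], fun _ _ => by simp [Sequent.empty]⟩
  | step _ hi hK hΨ' ih => exact hi.tame hK ih hΨ'

/-- A rule of high rank remains applicable after replacing the part of low rank. -/
theorem Inference.rder_comb {K : Kind} {Pr : Set (Sequent L)} (hi : Inference O Cr K e Ψ Pr)
    (hK : HighRule n K (e.rk O)) (hV : Ψ.RecordsΩ O) (hX : Low O n X) (hfit : Fits O n Ψ X)
    (hΨ' : Ψ' ∈ Pr) (hd : RDer O Cr (Sum.inlₗ n) (Ψ'.comb O n X)) :
    RDer O Cr (Sum.inlₗ n) (Ψ.comb O n X) := by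
  cases hi with
  | cut c Θ hr hc =>
    -- The value added by this `Cut` is overridden by `X`, so the given derivation already has the
    -- required end sequent.
    rcases hΨ' with rfl | ⟨v, rfl⟩
    · rwa [comb_addUnk_of_low hK] at hd
    · rwa [comb_addVal_of_low hK] at hd
  | cutFr => exact hK.elim
  | cutTerm c Θ hr => exact absurd (hr ▸ hK) (inl_lt_Ω n).not_ge
  | cutFrTerm => exact hK.elim
  | cutForm m => exact absurd hK (inl_lt_Ω n).not_ge
  | fr e Θ he =>
    obtain rfl := hΨ'
    rw [comb_addUnk_high hK] at hd
    refine .inf (.fr e _ ?_) (le_of_lt hK) fun Θ' hΘ' => ?_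
    · simpa [Subst.dom, comb_S_high hK] using he
    · obtain rfl := hΘ'
      exact hd
  | h e v Θ ha ht =>
    obtain rfl := hΨ'
    rw [← hSeq_comb hX hV hK] at hd
    refine .inf (.h e v _ (hfit.happlies hX ha) fun e' he' => ?_) (le_of_lt hK) fun Θ' hΘ' => ?_
    · have hact := (active_comb hX hV hK).1 he'
      rw [comb_F_high (hact.2.1 ▸ hK)]
      exact ht e' hact
    · obtain rfl := hΘ'
      exact hd

/-- Going back along the path removes the high part one rule at a time, until only `X` is left over
the empty sequent. In a derivation this reads as rebuilding the high part that an `H`-step of low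
rank has erased. -/
theorem Path.rder (h : Path O Cr (HighRule n) Ψ) (hX : Low O n X)
    (hle : ∀ e u, e.rk O ≤ Sum.inlₗ n → Ψ.S e = some u → X.S e = some u)
    (hjust : ∀ e u, X.S e = some u → X.S.Sat (FFm O e u))
    (hd : RDer O Cr (Sum.inlₗ n) (Ψ.comb O n X)) : RDer O Cr (Sum.inlₗ n) X := by
  induction h with
  | nil => rwa [hX.comb_empty] at hd
  | @step K e Ψ Ψ' Pr hΨ hi hK hΨ' ih =>
    have hle' : ∀ e u, e.rk O ≤ Sum.inlₗ n → Ψ.S e = some u → X.S e = some u := fun e u he hu =>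
      hle e u he (hi.low_le hK hΨ.tame.records hΨ' he hu)
    exact ih hle' (hi.rder_comb hK hΨ.tame.records hX ⟨hle', fun e u hu => Or.inr (hjust e u hu)⟩
      hΨ' hd)

end Steps

-- Deciding formulas by cuts of rank less than `n`

section Deciding

variable {L : FirstOrder.Language.{0, 0}} [L.Structure ℕ] {O : OpForm L} {N : ℕ}
  {Cr : Fin (N + 1) → Crit L} {n : ℕ}

variable (O n) in
/-- `X'` extends `X` by fixed expressions whose values are justified. -/
structure Extends (X X' : Sequent L) : Prop where
  low : Low O n X'
  le : X.S.Le X'.S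
  temp : ∀ e, X'.F e = some true → X.F e = some true
  just : ∀ e u, X'.S e = some u → X.S e = some u ∨ X'.S.Sat (FFm O e u)

theorem Extends.refl {X : Sequent L} (hX : Low O n X) : Extends O n X X :=
  ⟨hX, .refl _, fun _ h => h, fun _ _ => Or.inl⟩

theorem Extends.trans {X X' X'' : Sequent L} (h : Extends O n X X') (h' : Extends O n X' X'') :
    Extends O n X X'' :=
  ⟨h'.low, h.le.trans h'.le, fun e he => h.temp e (h'.temp e he), fun e u hu =>
    (h'.just e u hu).elim (fun hu => (h.just e u hu).imp_right h'.le.sat) Or.inr⟩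

variable (O Cr n) in
/-- `X` is derivable if all those extensions are derivable which have the property `Q`. -/
def Enforces (Q : Subst L → Prop) : Prop :=
  ∀ X, Low O n X → (∀ X', Extends O n X X' → Q X'.S → RDer O Cr (Sum.inlₗ n) X') →
    RDer O Cr (Sum.inlₗ n) X

/-- The second condition is reached in a further extension, so `hQ` must transport the first one
along it. -/
theorem Enforces.bind {Q Q' Q'' : Subst L → Prop} (h : Enforces O Cr n Q)
    (h' : Enforces O Cr n Q') (hQ : ∀ S S', S.Le S' → Q S → Q' S' → Q'' S') :
    Enforces O Cr n Q'' := fun X hX hd =>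
  h X hX fun X' hX' hq => h' X' hX'.low fun X'' hX'' hq' =>
    hd X'' (hX'.trans hX'') (hQ _ _ hX''.le hq hq')

theorem Enforces.mono {Q Q' : Subst L → Prop} (h : Enforces O Cr n Q)
    (hQ : ∀ S, Q S → Q' S) : Enforces O Cr n Q' := fun X hX hd =>
  h X hX fun X' hX' hq => hd X' hX' (hQ _ hq)

theorem Enforces.eval_tuple {k : ℕ} {ts : Fin k → CTm L}
    (h : ∀ i, Enforces O Cr n fun S => ∃ a, (ts i).eval S = some a) :
    Enforces O Cr n fun S => ∃ a : Fin k → ℕ, ∀ i, (ts i).eval S = some (a i) := by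
  have key : ∀ s : Finset (Fin k),
      Enforces O Cr n fun S => ∀ i ∈ s, ∃ a, (ts i).eval S = some a := fun s => by
    classical
    induction s using Finset.induction_on with
    | empty => exact fun X hX hd => hd X (.refl hX) (by simp)
    | insert i s _ ih =>
      refine ih.bind (h i) fun S S' hS hs hi j hj => ?_
      rcases Finset.mem_insert.1 hj with rfl | hj
      · exact hi
      · obtain ⟨a, ha⟩ := hs j hj
        exact ⟨a, hS.evalTm ha⟩
  exact (key Finset.univ).mono fun S hS => by
    choose a ha using fun i => hS i (Finset.mem_univ i)
    exact ⟨a, ha⟩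

/-- The arguments are evaluated first; a `Cut` then supplies the value of the resulting canonical
term. The hypothesis `ih` is needed because each numerical value so introduced has to be justified.
-/
theorem Enforces.eval_term {m : ℕ} (hm : m < n)
    (ih : ∀ m' < m, ∀ φ : CFm L, φ.All (LowIndex m') False →
      Enforces O Cr n fun S => S.Decides φ) (t : CTm L) (ht : t.All (LowIndex m)) :
    Enforces O Cr n fun S => ∃ a, t.eval S = some a := by
  induction t with
  | zero => exact fun X hX hd => hd X (.refl hX) ⟨0, rfl⟩
  | succ t iht =>
    exact (iht ht).mono fun S ⟨a, ha⟩ => ⟨a + 1, by simp [CTm.eval, ha]⟩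
  | func f ts iht =>
    exact (eval_tuple fun i => iht i (ht i)).mono fun S ⟨a, ha⟩ =>
      ⟨_, by simp only [CTm.eval, seqOpt_eq_some.2 ha]; rfl⟩
  | @sk k φ ts iht =>
    intro X hX hd
    refine eval_tuple (fun i => iht i (ht.2 i)) X hX fun X' hX' ⟨a, ha⟩ => ?_
    set c : CanTerm L := ⟨k, φ, a⟩ with hc
    have hrk : (CExpr.term c).rk O = Sum.inlₗ (φ.rkS + 1) := rk_term_of_not_hasI ht.1.2
    have hlt : (CExpr.term c).rk O < Sum.inlₗ n := hrk ▸ inl_lt_inl.2 (ht.1.1.trans_lt hm)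
    have heval : ∀ X'', Extends O n X' X'' → ∀ u, X''.S (.term c) = some u →
        RDer O Cr (Sum.inlₗ n) X'' := fun X'' hX'' u hu => by
      refine hd X'' (hX'.trans hX'') ?_
      simp only [CTm.eval, seqOpt_eq_some.2 fun i => hX''.le.evalTm (ha i), Option.bind_some,
        ← hc, hu]
      cases u with
      | unk => exact ⟨_, rfl⟩
      | num u => exact ⟨_, rfl⟩
      | top => exact absurd hu (hX''.low.ne_top _)
    cases hS : X'.S (.term c) with
    | some u => exact heval X' (.refl hX'.low) u hS
    | none =>
      refine .inf (.cut c X' (hrk ▸ (inl_lt_Ω _).ne) (by simp [Subst.dom, hS])) hlt ?_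
      rintro Θ' (rfl | ⟨u, rfl⟩)
      · refine heval _ ⟨hX'.low.addUnk hlt.le (by simp), Subst.le_set hS _, fun e he => ?_,
          fun e u hu => ?_⟩ .unk (Subst.set_self _ _ _)
        · by_cases hne : e = .term c
          · simp [Sequent.addUnk, hne] at he
          · simpa [Sequent.addUnk, hne] using he
        · by_cases hne : e = .term c
          · obtain rfl : Val.unk = u :=
              Option.some_inj.1 ((Subst.set_self _ _ _).symm.trans (hne ▸ hu))
            exact Or.inr (sat_FFm_unk _ _)
          · exact Or.inl ((Subst.set_of_ne hne _ _).symm.trans hu)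
      -- Deciding `F(c, u)` involves only smaller ranks. If it is true, the new value is justified;
      -- if it is false, the sequent is computationally inconsistent.
      · have hlow : Low O n (X'.addVal (.term c) u) := hX'.low.addVal hlt.le hS u
        refine ih φ.rkS ht.1.1 (FFm O (.term c) (.num u))
          (FFm_term_all O c _ ht.1.2) _ hlow fun X'' hX'' hdec => ?_
        have hu : X''.S (.term c) = some (.num u) := hX''.le _ _ (Subst.set_self _ _ _)
        rcases hdec with hs | hs
        · refine heval X'' ⟨hX''.low, (Subst.le_set hS _).trans hX''.le, hX''.temp,
            fun e v hv => ?_⟩ _ hu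
          by_cases hne : e = .term c
          · obtain rfl : Val.num u = v := Option.some_inj.1 (hu.symm.trans (hne ▸ hv))
            exact Or.inr (hne ▸ hs)
          · exact (hX''.just e v hv).imp_left (Subst.set_of_ne hne _ _).symm.trans
        · exact .ax (.axF (Or.inl ⟨_, _, hu, hs⟩))

/-- Cuts of rank less than `n` decide any formula with Skolem functions of such ranks. -/
theorem Enforces.decides {m : ℕ} (hm : m < n) (φ : CFm L) (hφ : φ.All (LowIndex m) False) :
    Enforces O Cr n fun S => S.Decides φ := by
  induction m using Nat.strong_induction_on generalizing φ with
  | _ m ih =>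
    have ht := eval_term (O := O) (Cr := Cr) hm fun m' hm' φ hφ => ih m' hm' (hm'.trans hm) φ hφ
    simp only [Subst.decides_iff, Option.isSome_iff_exists]
    induction φ with
    | eq s t =>
      refine (ht s hφ.1).bind (ht t hφ.2) fun S S' hS ⟨a, ha⟩ ⟨b, hb⟩ => ?_
      exact ⟨_, by simp only [CFm.eval, hS.evalTm ha, hb]; rfl⟩
    | rel R ts =>
      exact (eval_tuple fun i => ht (ts i) (hφ i)).mono fun S ⟨a, ha⟩ =>
        ⟨_, by simp only [CFm.eval, seqOpt_eq_some.2 ha]; rfl⟩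
    | mem t => exact hφ.1.elim
    | not φ ihφ =>
      exact (ihφ hφ).mono fun S ⟨a, ha⟩ => ⟨_, by simp only [CFm.eval, ha]; rfl⟩
    | and φ ψ ihφ ihψ =>
      refine (ihφ hφ.1).bind (ihψ hφ.2) fun S S' hS ⟨a, ha⟩ ⟨b, hb⟩ => ?_
      exact ⟨_, by simp only [CFm.eval, hS.evalFm ha, hb]; rfl⟩
    | or φ ψ ihφ ihψ =>
      refine (ihφ hφ.1).bind (ihψ hφ.2) fun S S' hS ⟨a, ha⟩ ⟨b, hb⟩ => ?_
      exact ⟨_, by simp only [CFm.eval, hS.evalFm ha, hb]; rfl⟩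

end Deciding

-- Elimination of cuts

section Elimination

variable {L : FirstOrder.Language.{0, 0}} [L.Structure ℕ] {O : OpForm L} {N : ℕ}
  {Cr : Fin (N + 1) → Crit L} {n : ℕ} {Ψ Ψ' X X' : Sequent L} {e : CExpr L}

variable (O Cr n) in
/-- Whenever the value of `e` is revised in an extension of the part of `Ψ` of rank at most `n`, in
which only those expressions of `Ψ` are temporary that are so in `X`, the result is derivable. -/
def Revisable (Ψ X : Sequent L) (e : CExpr L) : Prop :=
  ∀ (X' : Sequent L) (v : ℕ+), Low O n X' → X'.S e = some (.num v) →
    (∀ e' u, e' ≠ e → e'.rk O ≤ Sum.inlₗ n → Ψ.S e' = some u → X'.S e' = some u) →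
    (∀ e' ∈ Ψ.S.dom, X'.F e' = some true → X.F e' = some true) →
    (∀ e' u, e' ≠ e → X'.S e' = some u → X'.S.Sat (FFm O e' u)) →
    RDer O Cr (Sum.inlₗ n) X'

/-- Enlarging `Ψ` strengthens the demands on the revised low part, and a shorter list of temporary
expressions in `X` does too; so a promise made low in the derivation remains valid further up. -/
theorem Revisable.mono (h : Revisable O Cr n Ψ X e)
    (hΨ : ∀ e u, e.rk O ≤ Sum.inlₗ n → Ψ.S e = some u → Ψ'.S e = some u)
    (hF : ∀ e ∈ Ψ.S.dom, X'.F e = some true → X.F e = some true) :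
    Revisable O Cr n Ψ' X' e := fun X'' v hX'' hv hle htemp hjust =>
  h X'' v hX'' hv (fun e' u hne he' hu => hle e' u hne he' (hΨ e' u he' hu))
    (fun e' hd ht => hF e' hd <| htemp e' (by
      obtain ⟨u, hu⟩ := Option.isSome_iff_exists.1 hd
      simp [Subst.dom, hΨ e' u (hX''.temp e' ht).le hu]) ht) hjust

variable (O Cr n) in
/-- `X` is fit to replace the part of low rank of `Ψ`, the temporary expressions of `X` that occur in
`Ψ` being revisable. -/
structure Replaces (Ψ X : Sequent L) : Prop where
  low : Low O n X
  fits : Fits O n Ψ X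
  revisable : ∀ e ∈ Ψ.S.dom, X.F e = some true → Revisable O Cr n Ψ X e

/-- The value of a temporary main expression of a `Cut` can be revised if all other premises of
the `Cut` are derivable. -/
theorem Path.revisable_addUnk (hΨ : Path O Cr (HighRule n) Ψ) {c : CanTerm L}
    (hc : (CExpr.term c).rk O = Sum.inlₗ n) (hn : Ψ.S (.term c) = none)
    (hX : ∀ e ∈ Ψ.S.dom, X.F e = some true → Revisable O Cr n Ψ X e)
    (ih : ∀ (v : ℕ+) (X' : Sequent L), Replaces O Cr n (Ψ.addVal (.term c) v) X' →
      RDer O Cr (Sum.inlₗ n) ((Ψ.addVal (.term c) v).comb O n X')) :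
    Revisable O Cr n (Ψ.addUnk (.term c) false) X (.term c) := by
  intro X₁ v hX₁ hv hle htemp hjust
  obtain ⟨hI, hm⟩ := rk_term_eq_inl hc
  -- The rank `n` of the term is one more than the simple rank of its body, so cuts of rank less
  -- than `n` suffice.
  refine Enforces.decides (m := c.body.rkS) (by omega) (FFm O (.term c) (.num v))
    (FFm_term_all O c _ hI) X₁ hX₁ fun X₂ hX₂ hdec => ?_
  have hv₂ := hX₂.le _ _ hv
  have hdom : ∀ e ∈ Ψ.S.dom, e ≠ .term c := by
    rintro _ he rfl
    simp [Subst.dom, hn] at he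
  have hle₂ : ∀ e u, e.rk O ≤ Sum.inlₗ n → Ψ.S e = some u → X₂.S e = some u := fun e u he hu => by
    have hne : e ≠ .term c := hdom e (by simp [Subst.dom, hu])
    exact hX₂.le _ _ (hle e u hne he ((Subst.set_of_ne hne _ _).trans hu))
  rcases hdec with hs | hs
  · have hjust₂ : ∀ e u, X₂.S e = some u → X₂.S.Sat (FFm O e u) := fun e u hu => by
      by_cases hne : e = .term c
      · subst hne
        obtain rfl : Val.num v = u := Option.some_inj.1 (hv₂.symm.trans hu)
        exact hs
      · exact (hX₂.just e u hu).elim (fun h => hX₂.le.sat (hjust e u hne h)) id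
    -- Replaying the path to `Ψ` restores its high part. Since the new low part already has the
    -- value `v`, this sequent equally combines the premise `(e, v)` of the `Cut`, to which `ih`
    -- applies.
    refine hΨ.rder hX₂.low hle₂ hjust₂ ?_
    rw [← comb_addVal_of_low (e := .term c) hc.le v]
    have hF : ∀ e ∈ Ψ.S.dom, X₂.F e = some true → X.F e = some true := fun e he ht =>
      htemp e (by simpa [Subst.dom, Sequent.addUnk, Subst.set_of_ne (hdom e he)] using he)
        (hX₂.temp e ht)
    refine ih v X₂ ⟨hX₂.low, ⟨fun e u he hu => ?_, fun e u hu => Or.inr (hjust₂ e u hu)⟩,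
      fun e he ht => ?_⟩
    · by_cases hne : e = .term c
      · subst hne
        exact hv₂.trans ((Subst.set_self _ _ _).symm.trans hu)
      · exact hle₂ e u he ((Subst.set_of_ne hne _ _).symm.trans hu)
    -- The revised expression has a numerical value and hence no label. Every other temporary
    -- expression of `Ψ` was temporary in `X` and is still revisable.
    · have hne : e ≠ .term c := by
        rintro rfl
        rw [hX₂.low.F_eq_none (by simp [hv₂])] at ht
        simp at ht
      have he' : e ∈ Ψ.S.dom := by
        simpa [Subst.dom, Sequent.addVal, Subst.set_of_ne hne] using he
      exact (hX e he' (hF e he' ht)).mono (fun e u _ hu => Subst.le_set hn _ _ _ hu) hF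
  · exact .ax (.axF (Or.inl ⟨_, _, hv₂, hs⟩))

-- Extension preserves every axiom except an `AxH` of rank at most `n` whose `H`-expression has
-- become temporary. There an `H` rule of rank exactly `n` applies, and its premise is covered by
-- revisability.
open Classical in
theorem Replaces.rder_of_isAxiom (h : Replaces O Cr n Ψ X) (hV : Ψ.RecordsΩ O) (ha : IsAxiom O Cr Ψ) :
    RDer O Cr (Sum.inlₗ n) (Ψ.comb O n X) := by
  have hle := le_comb h.fits.le
  cases ha with
  | axF ha => exact .ax (.axF (ha.mono hle))
  | axS ha ha' => exact .ax (isAxiom_of_solving hle ha ha')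
  | axH e v ha e' hact hfix =>
    have ha' := h.fits.happlies h.low ha
    rcases lt_or_ge (Sum.inlₗ n) (e.rk O) with he | he
    · refine .ax (.axH e v ha' e' ((active_comb h.low hV he).2 hact) ?_)
      rwa [comb_F_high (hact.2.1 ▸ he)]
    · have hΩ : e.rk O < Ω := he.trans_lt (inl_lt_Ω n)
      obtain rfl := hact.eq_of_lt_Ω hΩ
      obtain ⟨i, -, hp, -⟩ := ha.main
      have hunk : X.S e' = some .unk := h.fits.le _ _ he ha.unk
      obtain ⟨b, hb⟩ := Option.isSome_iff_exists.1 ((h.low.domF e').2 hunk)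
      cases b with
      | false =>
        exact .ax (.axH e' v ha' e' (active_self hΩ ha'.unk hp.ne_unk)
          (by rwa [comb_F_low he]))
      -- If this step were omitted, a temporary label would block `AxH`; temporary expressions have
      -- rank exactly `n`, so the `H` rule is admitted in an `n`-derivation.
      | true =>
        have hrk := h.low.temp e' hb
        refine .inf (.h e' v _ ha' fun e'' he'' => ?_) hrk.ge ?_
        · rw [he''.eq_of_lt_Ω hΩ, comb_F_low he, hb]
        · rintro Θ' rfl
          obtain ⟨c, rfl⟩ := exists_term_of_rk_le he
          obtain ⟨w, rfl⟩ := hp.isNum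
          set Y := hSeq O (.term c) (.num w) (Ψ.comb O n X) with hY
          have hS : Y.S = X.S.set (.term c) (.num w) := by
            change (hData O _ _ _).1 = _
            rw [hData_of_lt_Ω hΩ]
            funext e
            by_cases hne : e = .term c
            · subst hne
              exact (Subst.set_self _ _ _).trans (Subst.set_self _ _ _).symm
            refine (Subst.set_of_ne hne _ _).trans (Eq.trans ?_ (Subst.set_of_ne hne _ _).symm)
            by_cases hr : e.rk O ≤ Sum.inlₗ n
            · rw [Subst.filter_of_forall fun _ => by rwa [hrk], comb_S_low hr]
            -- Values of rank above `n` are erased by the `H`-step, and `X` has none.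
            · rw [Subst.filter_of_not fun _ => by rwa [hrk]]
              cases hu : X.S e with
              | none => rfl
              | some u => exact absurd (h.low.rank e u hu) hr
          have hSe : Y.S (.term c) = some (.num w) := by rw [hS, Subst.set_self]
          have hSne : ∀ e, e ≠ .term c → Y.S e = X.S e := fun e hne => by
            rw [hS, Subst.set_of_ne hne]
          have hrank : ∀ e u, Y.S e = some u → e.rk O ≤ Sum.inlₗ n := fun e u hu => by
            by_cases hne : e = .term c
            · rwa [hne]
            · exact h.low.rank e u ((hSne e hne).symm.trans hu)
          have hFdef : ∀ e, Y.F e = match Y.S e with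
              | none => none
              | some u => if u = .unk ∨ e.rk O = Ω then
                  some (((Ψ.comb O n X).F e).getD true) else none := fun e => rfl
          have hF : ∀ e, Y.F e = if e = .term c then none else X.F e := fun e => by
            rw [hFdef]
            by_cases hne : e = .term c
            · subst hne
              simp [hSe, hΩ.ne]
            rw [hSne e hne, if_neg hne]
            have hd := h.low.domF e
            cases hu : X.S e with
            | none =>
              refine (h.low.F_eq_none ?_).symm
              simp [hu]
            | some u =>
              have hr := h.low.rank e u hu
              have hne' : e.rk O ≠ Ω := (hr.trans_lt (inl_lt_Ω n)).ne
              by_cases hu' : u = .unk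
              · subst hu'
                obtain ⟨b, hb⟩ := Option.isSome_iff_exists.1 (hd.2 hu)
                simp [comb_F_low hr, hb]
              · simp [hu', hne', h.low.F_eq_none (e := e) (by simpa [hu] using hu')]
          have hlow : Low O n Y := by
            refine ⟨?_, ?_, hrank, fun e => ?_, fun e => ?_, fun e he => ?_⟩
            · change (hData O _ _ _).2.1 = _
              rw [hData_of_lt_Ω hΩ]
            · change (hData O _ _ _).2.2 = _
              rw [hData_of_lt_Ω hΩ]
            · by_cases hne : e = .term c
              · rw [hne, hSe]
                simp
              · rw [hSne e hne]
                exact h.low.ne_top e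
            · rw [hF]
              by_cases hne : e = .term c
              · simp [hne, hSe]
              · rw [hSne e hne, if_neg hne]
                exact h.low.domF e
            · rw [hF] at he
              split_ifs at he
              exact h.low.temp e he
          refine h.revisable _ (by simp [Subst.dom, ha.unk]) hb Y w hlow hSe
            (fun e u hne hr hu => (hSne e hne).trans (h.fits.le e u hr hu)) (fun e _ ht => ?_)
            fun e u hne hu => ?_
          · rw [hF] at ht
            split_ifs at ht
            exact ht
          · have hr := hrank e u hu
            rw [hSne e hne] at hu
            obtain ⟨c', rfl⟩ := exists_term_of_rk_le hr
            -- The justification of any other value of rank at most `n` consults only ranks below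
            -- `n`, so changing the value of the `H`-expression, which has rank `n`, does not affect
            -- it.
            refine sat_FFm_congr hr (fun e' hr' u' hu' => ?_) (h.fits.sat_comb h.low ha.correct
              ha.computing ((comb_S_low hr).trans hu))
            rw [comb_S_low hr'.le] at hu'
            rw [hSne e' fun h' => by rw [h', hrk] at hr'; exact hr'.false]
            exact hu'

/-- Elimination of the cuts of rank `n`. -/
theorem RDer.rder_comb (hd : RDer O Cr (Sum.inlₗ (n + 1)) Ψ) (hΨ : Path O Cr (HighRule n) Ψ)
    (hX : Replaces O Cr n Ψ X) : RDer O Cr (Sum.inlₗ n) (Ψ.comb O n X) := by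
  induction hd generalizing X with
  | ax ha => exact hX.rder_of_isAxiom hΨ.tame.records ha
  | @inf K e Ψ Pr hi hK _ ih =>
    have hK' : HighRule n K (e.rk O) := by
      cases K with
      | cut => exact lt_inl_succ.1 hK
      | cutFr => exact hK
      | fr => exact inl_succ_le.1 hK
      | h => exact inl_succ_le.1 hK
    have hpath : ∀ Ψ' ∈ Pr, Path O Cr (HighRule n) Ψ' := fun Ψ' hΨ' => hΨ.step hi hK' hΨ'
    have hV := hΨ.tame.records
    have hmono : ∀ Ψ' ∈ Pr, ∀ e u, e.rk O ≤ Sum.inlₗ n → Ψ.S e = some u → Ψ'.S e = some u :=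
      fun Ψ' hΨ' e u he hu => hi.low_le hK' hV hΨ' he hu
    -- rules that do not touch the part of low rank
    have key : ∀ Ψ' ∈ Pr, (∀ e, e.rk O ≤ Sum.inlₗ n → Ψ'.S e = Ψ.S e) →
        RDer O Cr (Sum.inlₗ n) (Ψ.comb O n X) := fun Ψ' hΨ' hS => by
      have hdom : ∀ e, e.rk O ≤ Sum.inlₗ n → (e ∈ Ψ'.S.dom ↔ e ∈ Ψ.S.dom) := fun e he => by
        simp [Subst.dom, hS e he]
      refine hi.rder_comb hK' hV hX.low hX.fits hΨ' (ih Ψ' hΨ' (hpath Ψ' hΨ') ⟨hX.low,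
        ⟨fun e u he hu => hX.fits.le e u he ((hS e he).symm.trans hu), fun e u hu =>
          (hX.fits.just e u hu).imp_left (hdom e (hX.low.rank e u hu)).2⟩, fun e he ht => ?_⟩)
      exact (hX.revisable e ((hdom e (hX.low.temp e ht).le).1 he) ht).mono (hmono Ψ' hΨ')
        fun _ _ => id
    cases hi with
    | cutFr => exact hK.elim
    | cutTerm c Θ hr => exact absurd (hr ▸ hK') (inl_lt_Ω n).not_ge
    | cutFrTerm => exact hK.elim
    | cutForm m => exact absurd hK' (inl_lt_Ω n).not_ge
    | fr e Θ he =>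
      exact key _ rfl fun e' he' => Subst.set_of_ne (by rintro rfl; exact he'.not_gt hK') _ _
    | h e v Θ => exact key _ rfl fun e' he' => hData_S_low hV hK' he'
    | cut c Θ hr hc =>
      have hn : Ψ.S (.term c) = none := by simpa [Subst.dom] using hc
      have hne : ∀ e ∈ Ψ.S.dom, e ≠ .term c := by
        rintro _ he rfl
        exact hc he
      -- the premise of `Ψ` that agrees with the value of the main expression in `Y`
      have hprem : ∀ (Ψ' Y : Sequent L) (u : Val), Ψ'.S = Ψ.S.set (.term c) u → Low O n Y →
          X.S.Le Y.S → (∀ e u, e ≠ .term c → Y.S e = some u → X.S e = some u) →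
          (∀ e, e ≠ .term c → Y.F e = X.F e) → Y.S (.term c) = some u →
          (Y.F (.term c) = some true → Revisable O Cr n Ψ' Y (.term c)) →
          Replaces O Cr n Ψ' Y := by
        intro Ψ' Y u hΨ' hY hXY hYX hF hYc hrev
        have hle : ∀ e u, e.rk O ≤ Sum.inlₗ n → Ψ.S e = some u → Ψ'.S e = some u :=
          fun e u _ hu => hΨ' ▸ Subst.le_set hn _ _ _ hu
        refine ⟨hY, ⟨fun e w he hw => ?_, fun e w hw => ?_⟩, fun e he ht => ?_⟩
        · rw [hΨ'] at hw
          by_cases h : e = .term c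
          · subst h
            exact hYc.trans ((Subst.set_self _ _ _).symm.trans hw)
          · exact hXY _ _ (hX.fits.le e w he ((Subst.set_of_ne h _ _).symm.trans hw))
        · by_cases h : e = .term c
          · subst h
            left
            simp [Subst.dom, hΨ', Subst.set_self]
          · refine (hX.fits.just e w (hYX e w h hw)).imp (fun hd => ?_) hXY.sat
            simpa [Subst.dom, hΨ', Subst.set_of_ne h] using hd
        · by_cases h : e = .term c
          · subst h
            exact hrev ht
          · have he' : e ∈ Ψ.S.dom := by
              simpa [Subst.dom, hΨ', Subst.set_of_ne h] using he
            exact (hX.revisable e he' (hF e h ▸ ht)).mono hle fun e he ht =>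
              hF e (hne e he) ▸ ht
      have hmemU : Ψ.addUnk (.term c) false ∈ ({Ψ.addUnk (.term c) false} ∪
          Set.range fun u : ℕ+ => Ψ.addVal (.term c) u : Set (Sequent L)) := Or.inl rfl
      have hmemV : ∀ u, Ψ.addVal (.term c) u ∈ ({Ψ.addUnk (.term c) false} ∪
          Set.range fun u : ℕ+ => Ψ.addVal (.term c) u : Set (Sequent L)) := fun u =>
        Or.inr ⟨u, rfl⟩
      -- the main premise, with a label that may differ
      have hunk : ∀ Y : Sequent L, Low O n Y → X.S.Le Y.S →
          (∀ e u, e ≠ .term c → Y.S e = some u → X.S e = some u) →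
          (∀ e, e ≠ .term c → Y.F e = X.F e) → Y.S (.term c) = some .unk →
          RDer O Cr (Sum.inlₗ n) (Ψ.comb O n Y) := by
        intro Y hY hXY hYX hF hYc
        rw [← comb_addUnk_of_low (e := .term c) hK' false]
        refine ih _ hmemU (hpath _ hmemU) (hprem _ Y .unk rfl hY hXY hYX hF hYc fun ht => ?_)
        -- The induction hypotheses for the numerical premises are stored in the revisability of the
        -- main expression. A temporary expression of `Y` outside `Ψ` acquires this property only
        -- here, where its `Cut` is met.
        refine hΨ.revisable_addUnk (hY.temp _ ht) hn (fun e he ht => ?_)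
          fun v X' hX' => ih _ (hmemV v) (hpath _ (hmemV v)) hX'
        exact (hX.revisable e he (hF e (hne e he) ▸ ht)).mono (fun _ _ _ => id)
          fun e he ht => hF e (hne e he) ▸ ht
      have hval : ∀ (Y : Sequent L) (u : ℕ+), Low O n Y → X.S.Le Y.S →
          (∀ e u, e ≠ .term c → Y.S e = some u → X.S e = some u) →
          (∀ e, e ≠ .term c → Y.F e = X.F e) → Y.S (.term c) = some (.num u) →
          RDer O Cr (Sum.inlₗ n) (Ψ.comb O n Y) := by
        intro Y u hY hXY hYX hF hYc
        rw [← comb_addVal_of_low (e := .term c) hK' u]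
        refine ih _ (hmemV u) (hpath _ (hmemV u)) (hprem _ Y _ rfl hY hXY hYX hF hYc fun ht => ?_)
        rw [hY.F_eq_none (by simp [hYc])] at ht
        simp at ht
      cases hXc : X.S (.term c) with
      | some u =>
        cases u with
        | unk => exact hunk X hX.low (.refl _) (fun _ _ _ => id) (fun _ _ => rfl) hXc
        | num u => exact hval X u hX.low (.refl _) (fun _ _ _ => id) (fun _ _ => rfl) hXc
        | top => exact absurd hXc (hX.low.ne_top _)
      | none =>
        have hfresh : CExpr.term c ∉ (Ψ.comb O n X).S.dom := by
          simp [Subst.dom, comb_S_low hK', hXc]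
        have hU : ∀ i, (i = true → (CExpr.term c).rk O = Sum.inlₗ n) →
            RDer O Cr (Sum.inlₗ n) ((Ψ.comb O n X).addUnk (.term c) i) := fun i hrk => by
          rw [← comb_addUnk_right hK']
          refine hunk _ (hX.low.addUnk hK' hrk) (Subst.le_set hXc _)
            (fun e u h hu => (Subst.set_of_ne h _ _).symm.trans hu) (fun e h => ?_)
            (Subst.set_self _ _ _)
          simp [Sequent.addUnk, h]
        -- Cuts of smaller rank are kept. At rank `n` only the premise with value `?` is kept, now
        -- with a temporary label.
        rcases lt_or_eq_of_le hK' with hlt | heq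
        · refine .inf (.cut c _ hr hfresh) hlt ?_
          rintro Θ' (rfl | ⟨u, rfl⟩)
          · exact hU false (by simp)
          · dsimp only
            rw [← comb_addVal_right hK']
            exact hval _ u (hX.low.addVal hK' hXc u) (Subst.le_set hXc _)
              (fun e u h hu => (Subst.set_of_ne h _ _).symm.trans hu) (fun e h => rfl)
              (Subst.set_self _ _ _)
        · refine .inf (.fr _ _ hfresh) heq.ge ?_
          rintro Θ' rfl
          exact hU true fun _ => heq

-- The starting choice of `X` is the low part of `Ψ` itself. It contains no temporary expressions,
-- so revisability holds vacuously.
open Classical in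
theorem RDer.reduce (hd : RDer O Cr (Sum.inlₗ (n + 1)) Ψ) (hΨ : Path O Cr (HighRule n) Ψ) :
    RDer O Cr (Sum.inlₗ n) Ψ := by
  have ht := hΨ.tame
  set X : Sequent L := ⟨fun e => if e.rk O ≤ Sum.inlₗ n then Ψ.S e else none, [], fun _ => none,
    fun e => if e.rk O ≤ Sum.inlₗ n then Ψ.F e else none⟩ with hXdef
  have hS : ∀ e, X.S e = if e.rk O ≤ Sum.inlₗ n then Ψ.S e else none := fun _ => rfl
  have hF : ∀ e, X.F e = if e.rk O ≤ Sum.inlₗ n then Ψ.F e else none := fun _ => rfl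
  have hcomb : Ψ.comb O n X = Ψ := by
    refine Sequent.ext (funext fun e => ?_) rfl rfl (funext fun e => ?_) <;>
    by_cases he : e.rk O ≤ Sum.inlₗ n <;> simp [Sequent.comb, hXdef, he]
  have hfixed : ∀ e, X.F e ≠ some true := fun e h => by
    rw [hF] at h
    split_ifs at h with he
    exact ht.fixed e he h
  rw [← hcomb]
  refine hd.rder_comb hΨ ⟨⟨rfl, rfl, fun e u hu => ?_, fun e hu => ?_, fun e => ?_,
    fun e h => absurd h (hfixed e)⟩, ⟨fun e u he hu => ?_, fun e u hu => Or.inl ?_⟩,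
    fun e _ h => absurd h (hfixed e)⟩
  · rw [hS] at hu
    split_ifs at hu with he
    exact he
  · rw [hS] at hu
    split_ifs at hu with he
    exact ht.ne_top e he hu
  · rw [hS, hF]
    split_ifs with he
    · exact ht.domF e he
    · simp
  · rw [hS, if_pos he, hu]
  · rw [hS] at hu
    split_ifs at hu
    simp [Subst.dom, hu]

theorem PathRule.highRule {m : ℕ} (h : n ≤ m) (X : Kind) (q : Rank)
    (hX : PathRule (Sum.inlₗ n) (Ω ≤ ·) X q) : HighRule m X q := by
  cases X with
  | cut => exact le_trans (α := Rank) hX (inl_le_inl.2 h)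
  | cutFr => exact hX
  | fr => exact (inl_lt_Ω m).trans_le hX
  | h => exact (inl_lt_Ω m).trans_le hX

/-- The path qualifies at every rank from `n` upwards: its cuts have rank at most `n`, and its `Fr`
and `H` rules, of rank at least `Ω`, lie above every finite rank. -/
theorem RDer.reduce_of_le {m : ℕ} (h : n ≤ m) (hd : RDer O Cr (Sum.inlₗ m) Ψ)
    (hΨ : Path O Cr (PathRule (Sum.inlₗ n) (Ω ≤ ·)) Ψ) : RDer O Cr (Sum.inlₗ n) Ψ := by
  induction m, h using Nat.le_induction with
  | base => exact hd
  | succ m h ih => exact ih (hd.reduce (hΨ.mono (PathRule.highRule h)))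

/-- Elimination of all cuts of finite rank at least `n`. -/
theorem RDer.reduce_of_Ω (hd : RDer O Cr Ω Ψ)
    (hΨ : Path O Cr (PathRule (Sum.inlₗ n) (Ω ≤ ·)) Ψ) : RDer O Cr (Sum.inlₗ n) Ψ := by
  induction hd generalizing n with
  | ax ha => exact .ax ha
  | @inf K e Ψ Pr hi hK _ ih =>
    cases K with
    | cut =>
      obtain ⟨m, hm⟩ := exists_eq_inl_of_lt_Ω hK
      rcases lt_or_ge m n with h | h
      · have hlt : e.rk O < Sum.inlₗ n := hm ▸ inl_lt_inl.2 h
        exact .inf hi hlt fun Ψ' hΨ' => ih Ψ' hΨ' (hΨ.step hi hlt.le hΨ')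
      · have hlt : e.rk O < Sum.inlₗ (m + 1) := hm ▸ inl_lt_inl.2 m.lt_succ_self
        have hle : n ≤ m + 1 := h.trans m.le_succ
        -- The premises are brought to rank `m + 1`, the least rank at which this `Cut` of rank `m`
        -- is still admitted. The conclusion is then reduced from `m + 1` to `n`, using its own
        -- path, whose cuts have rank at most `n`.
        refine reduce_of_le hle (.inf hi hlt fun Ψ' hΨ' => ih Ψ' hΨ' ?_) hΨ
        refine (hΨ.mono fun X q hX => ?_).step hi (show PathRule _ _ _ _ from hlt.le) hΨ'
        cases X with
        | cut => exact le_trans (α := Rank) hX (inl_le_inl.2 hle)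
        | cutFr => exact hX
        | fr => exact hX
        | h => exact hX
    | cutFr => exact hK.elim
    | fr =>
      exact .inf hi ((inl_lt_Ω n).le.trans hK) fun Ψ' hΨ' => ih Ψ' hΨ' (hΨ.step hi hK hΨ')
    | h =>
      exact .inf hi ((inl_lt_Ω n).le.trans hK) fun Ψ' hΨ' => ih Ψ' hΨ' (hΨ.step hi hK hΨ')

end Elimination

end EpsID

theorem mainTheorem5 (L : FirstOrder.Language.{0, 0}) [L.Structure ℕ] (O : EpsID.OpForm L)
    (N : ℕ) (Cr : Fin (N + 1) → EpsID.Crit L) (r : EpsID.Rank) (hr : r ≤ EpsID.Ω)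
    (Θ : EpsID.Sequent L) (hseq : Θ.IsSequent O) (d : EpsID.Derivation O Cr Θ)
    (hd : d.IsRDeduction EpsID.Ω)
    (hΘ : EpsID.HasPath O Cr r Θ) :
    ∃ d' : EpsID.Derivation O Cr Θ, d'.IsRDeduction r := by
  rcases lt_or_eq_of_le hr with h | rfl
  · obtain ⟨n, rfl⟩ := EpsID.exists_eq_inl_of_lt_Ω h
    exact ((EpsID.RDer.of_derivation d hd).reduce_of_Ω hΘ.path).exists_derivation
  · exact ⟨d, hd⟩
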